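/- Let $k$ be a complete ultrametric valued field (the trivial absolute value is allowed), and let $\mathbf{A}^{1,\mathrm{an}}_k \subset \mathbf{P}^{1,\mathrm{an}}_k$ be the affine and projective Berkovich lines over $k$. For $x,y \in \mathbf{A}^{1,\mathrm{an}}_k$ put $$\delta(x,y) = \inf_P\, \max\big(|P(x)|,|P(y)|\big)^{1/\deg P},$$ where $P$ runs over the monic irreducible polynomials of $k[T]$. If $k$ is algebraically closed, $\delta(x,y)$ is the diameter of the smallest disc containing $x$ and $y$; in general $\log \delta(x,y)$ is the mean of this function over the preimages of $x$ and $y$ on the line over the completion of an algebraic closure of $k$. Let $I=[x,y]$ be a segment of $\mathbf{P}^{1,\mathrm{an}}_k$ whose end points are points of type 2 or 3, possibly equal. Its (logarithmic) length is $\ell(I) = 2\log\delta(x,y)-\log\delta(x,x)-\log\delta(y,y)$, so that the segment joining the maximal points $\eta_{\alpha,r}$ and $\eta_{\alpha,s}$ of the discs of centre $\alpha \in k$ and radii $r\le s$ has length $\log(s/r)$. Let $\mu_I$ be the Dirac measure at $x$ if $x=y$, and the Lebesgue measure of $I$ (for this length), normalized to have total mass $1$, otherwise. The energy of two such segments $I_a$,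 $I_b$ is $$E(I_a,I_b) = \tfrac12(\mu_{I_a}-\mu_{I_b},\mu_{I_a}-\mu_{I_b}), \qquad (\rho,\rho') = -\int \log \delta(z,w)\, d\rho(z)\otimes d\rho'(w).$$ Let $I_a$ and $I_b$ be two such segments with $I_{ab} := I_a\cap I_b \neq\emptyset$. Then $E(I_a,I_b)$ is well defined (that is, $\log\delta$ is integrable for $|\rho|\otimes|\rho|$ with $\rho=\mu_{I_a}-\mu_{I_b}$). Moreover $I_{ab}$ is a segment $[p,q]$ with end points of type 2 or 3, and the end points of $I_a$ and $I_b$ can be labelled so that $I_a=[a',a'']$ and $I_b=[b',b'']$ decompose as $$I_a = [a',p]\cup[p,q]\cup[q,a''],\qquad I_b=[b',p]\cup[p,q]\cup[q,b''],$$ where consecutive pieces meet in one point only and have a segment as their union (the pieces may be reduced to a point). For every such decomposition, denote by $\ell_a,\ell_b,\ell_{ab},\ell'_a,\ell''_a,\ell'_b,\ell''_b$ the lengths of $I_a$, $I_b$, $I_{ab}$, $[a',p]$, $[q,a'']$, $[b',p]$, $[q,b'']$. Then $$E(I_a,I_b) = \frac{\ell_a}6+\frac{\ell_b}6-\frac{\ell_{ab}}2+\frac{\ell_{ab}^3}{6\,\ell_a\ell_b}-\frac{\ell'_a\ell''_a}{2\,\ell_a}-\frac{\ell'_b\ell''_b}{2\,\ell_b}-\frac{(\ell'_a\ell'_b+\ell''_a\ell''_b)\,\ell_{ab}}{2\,\ell_a\ell_b},$$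 where a fraction whose denominator is $0$ (which happens only if $I_a$ or $I_b$ is reduced to a point) is read as $0$. -/

import Mathlib

open MeasureTheory Polynomial

noncomputable section

namespace Berkovich

/-- The Berkovich affine line over a valued field `k`: the multiplicative seminorms on `k[T]`
extending the absolute value of `k`. The Berkovich projective line is obtained by adding the point
`∞`. That point is an end of type 1, so it lies on no segment joining points of type 2 or 3:
segments with such end points, and the measures they carry, live on the affine line. -/
def AffineLine (k : Type*) [NormedField k] : Type _ :=
  {φ : MulRingSeminorm k[X] // ∀ a : k, φ (C a) = ‖a‖}

variable {k : Type*} [NormedField k]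

/-- The value `|P(x)|` of a polynomial at a point of the line. -/
def AffineLine.eval (x : AffineLine k) (P : k[X]) : ℝ := x.1 P

/-- The topology of the Berkovich line: the coarsest one for which all the maps `x ↦ |P(x)|` are
continuous. -/
instance : TopologicalSpace (AffineLine k) :=
  TopologicalSpace.induced AffineLine.eval inferInstance

instance : MeasurableSpace (AffineLine k) := borel _

instance : BorelSpace (AffineLine k) := ⟨rfl⟩

/-- The usual order of the line (with maximal element `∞` on the projective line). -/
instance : LE (AffineLine k) := ⟨fun x y => ∀ P : k[X], x.eval P ≤ y.eval P⟩

/-- `x = η_{α,r}`: the point `x` is (the image on the line over `k` of) the maximal point of the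
closed disc of centre `α` and radius `r`, where `α` lies in an algebraic closure of `k`, which
carries the unique extension of the absolute value of `k`. For `P = ∑ cᵢ (T - α)ⁱ` one has
`|P(x)| = maxᵢ |cᵢ| rⁱ`. -/
def IsDiscPoint (x : AffineLine k) (α : AlgebraicClosure k) (r : ℝ) : Prop :=
  ∀ P : k[X], x.eval P =
    ⨆ i : ℕ, spectralNorm k (AlgebraicClosure k)
      ((taylor α (P.map (algebraMap k (AlgebraicClosure k)))).coeff i) * r ^ i

/-- Points of type 2 or 3: the points `η_{α,r}` with `r > 0`. -/
def IsType23 (x : AffineLine k) : Prop :=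
  ∃ (α : AlgebraicClosure k) (r : ℝ), 0 < r ∧ IsDiscPoint x α r

/-- The ultrametric analogue `δ(x,y)` of `|z - w|` on the line. If `k` is algebraically closed, the
`P` are the `T - a` with `a ∈ k`, and
`δ(x,y) = inf_a max(|T - a|_x, |T - a|_y)` is the diameter of the smallest disc containing `x` and
`y`; in particular `δ(η_{α,r}, η_{β,s}) = max(r, s, |α - β|)`. In general, `log δ(x,y)` is the mean
of the values taken by this function over an algebraic closure at the preimages of `x` and `y`. -/
def kernel (x y : AffineLine k) : ℝ :=
  ⨅ P : {P : k[X] // P.Monic ∧ Irreducible P},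
    (max (x.eval P.1) (y.eval P.1)) ^ ((P.1.natDegree : ℝ)⁻¹)

/-- The length of the segment `[x,y]` between points of type 2 or 3. If `k` is algebraically
closed, and `D` is the diameter of the smallest disc containing `x = η_{α,r}` and `y = η_{β,s}`,
it is `log (D / r) + log (D / s)`. -/
def len (x y : AffineLine k) : ℝ :=
  2 * Real.log (kernel x y) - Real.log (kernel x x) - Real.log (kernel y y)

/-- The segment `[x,y]` between points of type 2 or 3: the points that are above `x` or above `y`
and below the join of `x` and `y`. (All the points above a point of type 2 or 3 are
of type 2 or 3.) -/
def seg (x y : AffineLine k) : Set (AffineLine k) :=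
  {z | IsType23 z ∧ (x ≤ z ∨ y ≤ z) ∧ ∀ w, IsType23 w → x ≤ w → y ≤ w → z ≤ w}

/-- The parametrization of `[x,y]` by the distance to `x`. -/
def segParam (x y : AffineLine k) : ℝ → AffineLine k :=
  haveI : Nonempty (AffineLine k) := ⟨x⟩
  Function.invFunOn (fun z => len x z) (seg x y)

open Classical in
/-- The measure `μ_I` for `I = [x,y]`: the Dirac mass if `I` is a point, and otherwise the image of
the Lebesgue measure on `I`, normalized to have total mass 1. -/
def segMeasure (x y : AffineLine k) : Measure (AffineLine k) :=
  if x = y then Measure.dirac x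
  else (ENNReal.ofReal (len x y))⁻¹ •
    (volume.restrict (Set.Icc 0 (len x y))).map (segParam x y)

instance (x y : AffineLine k) : IsFiniteMeasure (segMeasure x y) := by
  unfold segMeasure
  split_ifs with h
  · infer_instance
  · rcases le_or_gt (len x y) 0 with hl | hl
    · have h0 : (volume.restrict (Set.Icc 0 (len x y)) : Measure ℝ) = 0 := by
        rw [Measure.restrict_eq_zero, Real.volume_Icc, sub_zero]
        exact ENNReal.ofReal_eq_zero.2 hl
      rw [h0, Measure.map_zero, smul_zero]
      infer_instance
    · exact Measure.smul_finite _ (ENNReal.inv_ne_top.2 (by simpa using hl))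

/-- The function `log δ(z,w)`. Since `Real.log 0 = 0`, it vanishes where `δ(z,w) = 0`, that is, on
the diagonal of the points of type 1, which is excluded from the integrals below. -/
def logKernel (p : AffineLine k × AffineLine k) : ℝ := Real.log (kernel p.1 p.2)

/-- Integrability of `log δ` for `|ρ| ⊗ |ρ'|`. -/
def HasEnergy (ρ ρ' : SignedMeasure (AffineLine k)) : Prop :=
  Integrable logKernel (ρ.totalVariation.prod ρ'.totalVariation)

/-- `∫ log δ(z,w) dμ(z) ⊗ dν(w)` for (positive) measures. -/
def kernelIntegral (μ ν : Measure (AffineLine k)) : ℝ := ∫ z, logKernel z ∂(μ.prod ν)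

/-- The mutual energy `(ρ,ρ') = - ∫ log δ(z,w) dρ(z) ⊗ dρ'(w)` of signed measures, the integral
being expanded along the Jordan decompositions of `ρ` and `ρ'`. -/
def energyPairing (ρ ρ' : SignedMeasure (AffineLine k)) : ℝ :=
  -(kernelIntegral ρ.toJordanDecomposition.posPart ρ'.toJordanDecomposition.posPart
    - kernelIntegral ρ.toJordanDecomposition.posPart ρ'.toJordanDecomposition.negPart
    - kernelIntegral ρ.toJordanDecomposition.negPart ρ'.toJordanDecomposition.posPart
    + kernelIntegral ρ.toJordanDecomposition.negPart ρ'.toJordanDecomposition.negPart)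

/-- The signed measure `μ_{[x,x']} - μ_{[y,y']}`. -/
def segDiff (x x' y y' : AffineLine k) : SignedMeasure (AffineLine k) :=
  (segMeasure x x').toSignedMeasure - (segMeasure y y').toSignedMeasure

/-- The energy `E(I_a, I_b) = ½ (μ_{I_a} - μ_{I_b}, μ_{I_a} - μ_{I_b})` for `I_a = [x,x']` and
`I_b = [y,y']`. -/
def segEnergy (x x' y y' : AffineLine k) : ℝ :=
  1 / 2 * energyPairing (segDiff x x' y y') (segDiff x x' y y')

/-- Two sets can be fitted together if they meet in exactly one point and their union is a segment
with end points of type 2 or 3. -/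
def Fit (I J : Set (AffineLine k)) : Prop :=
  (∃ z, I ∩ J = {z}) ∧ ∃ x y, IsType23 x ∧ IsType23 y ∧ I ∪ J = seg x y

/-- The configuration of two segments `I_a = [a',a'']` and `I_b = [b',b'']` that meet along
`I_ab = [p,q]`. One has `I_a = I'_a ∪ I_ab ∪ I''_a` and `I_b = I'_b ∪ I_ab ∪ I''_b` with
`I'_a = [a',p]`, `I''_a = [q,a'']`, `I'_b = [b',p]`, `I''_b = [q,b'']`, consecutive pieces fit
together, and `I'_a` and `I'_b` are on the same side of `I_ab`, that of `p`. -/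
structure MeetAlong (a' a'' b' b'' p q : AffineLine k) : Prop where
  type_p : IsType23 p
  type_q : IsType23 q
  inter_eq : seg a' a'' ∩ seg b' b'' = seg p q
  a_eq : seg a' a'' = seg a' p ∪ seg p q ∪ seg q a''
  b_eq : seg b' b'' = seg b' p ∪ seg p q ∪ seg q b''
  fit_a' : Fit (seg a' p) (seg p q)
  fit_a'' : Fit (seg p q) (seg q a'')
  fit_b' : Fit (seg b' p) (seg p q)
  fit_b'' : Fit (seg p q) (seg q b'')

end Berkovich

end

noncomputable section

namespace Berkovich

/-! ### The absolute value of the algebraic closure, Gauss norms of discs, conjugates. -/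

section

variable {k : Type*} [NormedField k]

/-! ### The absolute value of the algebraic closure -/

section SpectralAbs

variable [IsUltrametricDist k]

/-! The energy is a mean distance in a tree. By definition `2 log δ(z,w) = ℓ(z,w) + log δ(z,z) + log
δ(w,w)`, and `ρ = μ_{I_a} - μ_{I_b}` has total mass 0, so the diagonal terms cancel in `(ρ,ρ)`.
Hence `E(I_a,I_b)` is half the mean distance of a point of `I_a` to a point of `I_b`, minus a
quarter of the mean distances inside `I_a` and inside `I_b`, which are `ℓ_a/3` and `ℓ_b/3`
(`segEnergy_eq_integral_len`).

That `ℓ` is a tree metric rests on an explicit formula for `δ`. At `η_{α,r}` the value of the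
minimal polynomial of `γ`, normalized by its degree, is the geometric mean of `max (r, |α - γ'|)`
over the conjugates `γ'` of `γ`. It depends only on `γ` and on the larger of `r` and the distance of
the Galois orbits of `α` and `γ` (`meanDist_eq_meanDiam`). So the infimum defining `δ(η_{α,r},
η_{β,s})` is attained at the minimal polynomial of `β` (`IsDiscPoint.kernel_eq`), and `δ` satisfies
the ultrametric inequality. This yields the four-point inequality for `ℓ`, the identification of
segments with metric intervals (`IsType23.mem_seg_iff`) and projections to segments
(`IsType23.exists_gate`).

Projecting `I_a` to `I_b` gives the decomposition along `[p,q]` and the distance as a function of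
one coordinate on each segment (`MeetAlong.len_eq`). The mean distance is then an elementary double
integral (`integral_integral_dist`). The Jordan decomposition of `ρ` is never computed: its parts
are dominated by the two measures, and the expansion of a bilinear integral does not depend on how
`ρ` is written as a difference (`integral_prod_sub_eq`). -/

theorem spectralNorm_eq_one_of_trivial (h : ∀ a : k, ‖a‖ ≤ 1) {y : AlgebraicClosure k}
    (hy : y ≠ 0) : spectralNorm k (AlgebraicClosure k) y = 1 := by
  have hle : ∀ z : AlgebraicClosure k, spectralNorm k (AlgebraicClosure k) z ≤ 1 := fun z =>
    (spectralValue_le_one_iff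
      (minpoly.monic (Algebra.IsAlgebraic.isAlgebraic (R := k) z).isIntegral)).2 fun n => h _
  have hmul := spectralNorm_mul (Algebra.IsAlgebraic.isAlgebraic (R := k) y)
    (Algebra.IsAlgebraic.isAlgebraic (R := k) y⁻¹)
  rw [mul_inv_cancel₀ hy, spectralNorm_one] at hmul
  have h0 := spectralNorm_nonneg (K := k) y
  exact le_antisymm (hle y) (hmul.trans (mul_le_of_le_one_right h0 (hle _)))

/-- If all norms are at most 1, the extended norm is 1 away from 0. Otherwise `k` is nontrivially
normed and complete, and `spectralAlgNorm_mul` applies. -/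
theorem spectralNorm_mul_eq [CompleteSpace k] (x y : AlgebraicClosure k) :
    spectralNorm k (AlgebraicClosure k) (x * y) =
      spectralNorm k (AlgebraicClosure k) x * spectralNorm k (AlgebraicClosure k) y := by
  by_cases h : ∀ a : k, ‖a‖ ≤ 1
  · rcases eq_or_ne x 0 with rfl | hx
    · simp [spectralNorm_zero]
    rcases eq_or_ne y 0 with rfl | hy
    · simp [spectralNorm_zero]
    rw [spectralNorm_eq_one_of_trivial h hx, spectralNorm_eq_one_of_trivial h hy,
      spectralNorm_eq_one_of_trivial h (mul_ne_zero hx hy), one_mul]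
  · push Not at h
    let : NontriviallyNormedField k := { ‹NormedField k› with non_trivial := h }
    exact spectralAlgNorm_mul x y

variable [CompleteSpace k]

variable (k) in
/-- The extension of the absolute value of `k` to its algebraic closure. -/
def spectralAbs : AbsoluteValue (AlgebraicClosure k) ℝ where
  toFun := spectralNorm k (AlgebraicClosure k)
  map_mul' := spectralNorm_mul_eq
  nonneg' := spectralNorm_nonneg
  eq_zero' x := ⟨fun h => eq_zero_of_map_spectralNorm_eq_zero h
    (Algebra.IsAlgebraic.isAlgebraic x), fun h => h ▸ spectralNorm_zero⟩
  add_le' x y := (isNonarchimedean_spectralNorm x y).trans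
    (max_le_add_of_nonneg (spectralNorm_nonneg _) (spectralNorm_nonneg _))

theorem spectralAbs_apply (x : AlgebraicClosure k) :
    spectralAbs k x = spectralNorm k (AlgebraicClosure k) x := rfl

theorem isNonarchimedean_spectralAbs : IsNonarchimedean (spectralAbs k) :=
  isNonarchimedean_spectralNorm

theorem spectralAbs_algebraMap (a : k) :
    spectralAbs k (algebraMap k (AlgebraicClosure k) a) = ‖a‖ :=
  spectralNorm_extends a

theorem spectralAbs_algEquiv (σ : Gal(AlgebraicClosure k/k)) (x : AlgebraicClosure k) :
    spectralAbs k (σ x) = spectralAbs k x :=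
  (spectralNorm_eq_of_equiv σ x).symm

theorem spectralAbs_sub_le (x y z : AlgebraicClosure k) :
    spectralAbs k (x - z) ≤ max (spectralAbs k (x - y)) (spectralAbs k (y - z)) := by
  simpa using isNonarchimedean_spectralAbs (x - y) (y - z)

/-- Any point of an ultrametric disc may serve as its centre. -/
theorem max_spectralAbs_congr {α β : AlgebraicClosure k} {r : ℝ}
    (h : spectralAbs k (α - β) ≤ r) (γ : AlgebraicClosure k) :
    max r (spectralAbs k (α - γ)) = max r (spectralAbs k (β - γ)) := by
  have h1 := spectralAbs_sub_le α β γ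
  have h2 := spectralAbs_sub_le β α γ
  rw [(spectralAbs k).map_sub β α] at h2
  apply le_antisymm
  · exact max_le (le_max_left _ _) (h1.trans (max_le_max_right _ h))
  · exact max_le (le_max_left _ _) (h2.trans (max_le_max_right _ h))

end SpectralAbs

/-! ### Gauss norms -/

theorem iSup_coeff_eq_gaussNorm {R : Type*} [Ring R] (v : AbsoluteValue R ℝ) {c : ℝ}
    (hc : 0 ≤ c) (p : R[X]) : ⨆ i : ℕ, v (p.coeff i) * c ^ i = p.gaussNorm v c := by
  rw [← gaussNorm_coe_powerSeries v p hc, PowerSeries.gaussNorm_eq]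
  simp

section DiscPoint

variable [IsUltrametricDist k] [CompleteSpace k]

theorem gaussNorm_taylor_X_sub_C (α γ : AlgebraicClosure k) {r : ℝ} (hr : 0 < r) :
    (taylor α (X - C γ)).gaussNorm (spectralAbs k) r = max r (spectralAbs k (α - γ)) := by
  have h : taylor α (X - C γ) = X + C (α - γ) := by
    simp [map_sub, add_sub_assoc]
  rw [h]
  apply le_antisymm
  · have := isNonarchimedean_gaussNorm (spectralAbs k) isNonarchimedean_spectralAbs hr.le
      (X : (AlgebraicClosure k)[X]) (C (α - γ))
    have hX : (X : (AlgebraicClosure k)[X]).gaussNorm (spectralAbs k) r = r := by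
      rw [← monomial_one_one_eq_X, gaussNorm_monomial, (spectralAbs k).map_one, one_mul, pow_one]
    rwa [gaussNorm_C, hX] at this
  · have h0 := le_gaussNorm (spectralAbs k) (X + C (α - γ)) hr.le 0
    have h1 := le_gaussNorm (spectralAbs k) (X + C (α - γ)) hr.le 1
    simp only [coeff_add, coeff_X_zero, coeff_C_zero, zero_add, pow_zero, mul_one, coeff_X_one,
      coeff_C_succ, add_zero, map_one, one_mul, pow_one] at h0 h1
    exact max_le h1 h0

/-- The Gauss norm on a disc in terms of the roots of the polynomial. -/
theorem gaussNorm_taylor_eq_prod_roots (α : AlgebraicClosure k) {r : ℝ} (hr : 0 < r)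
    (P : (AlgebraicClosure k)[X]) :
    (taylor α P).gaussNorm (spectralAbs k) r = spectralAbs k P.leadingCoeff *
      (P.roots.map fun γ => max r (spectralAbs k (α - γ))).prod := by
  have hmul : ∀ s : Multiset (AlgebraicClosure k),
      (taylor α (s.map fun γ => X - C γ).prod).gaussNorm (spectralAbs k) r =
        (s.map fun γ => max r (spectralAbs k (α - γ))).prod := by
    intro s
    induction s using Multiset.induction_on with
    | empty =>
      simp only [Multiset.map_zero, Multiset.prod_zero]
      rw [taylor_one, gaussNorm_C, map_one]
    | cons γ s ih =>
      rw [Multiset.map_cons, Multiset.prod_cons, taylor_mul,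
        gaussNorm_mul isNonarchimedean_spectralAbs hr, gaussNorm_taylor_X_sub_C α γ hr, ih,
        Multiset.map_cons, Multiset.prod_cons]
  conv_lhs => rw [(IsAlgClosed.splits P).eq_prod_roots]
  rw [taylor_mul, gaussNorm_mul isNonarchimedean_spectralAbs hr, taylor_C, gaussNorm_C, hmul]

/-- Multiplicativity of the Gauss norm turns the supremum over coefficients into a product over
roots, on which Galois acts by permutation. -/
theorem isDiscPoint_iff {x : AffineLine k} {α : AlgebraicClosure k} {r : ℝ} (hr : 0 < r) :
    IsDiscPoint x α r ↔ ∀ P : k[X], x.eval P = ‖P.leadingCoeff‖ *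
      ((P.aroots (AlgebraicClosure k)).map fun γ => max r (spectralAbs k (α - γ))).prod := by
  refine forall_congr' fun P => ?_
  have h := iSup_coeff_eq_gaussNorm (spectralAbs k) hr.le
    (taylor α (P.map (algebraMap k (AlgebraicClosure k))))
  simp only [spectralAbs_apply] at h
  rw [h, gaussNorm_taylor_eq_prod_roots α hr, leadingCoeff_map, spectralAbs_algebraMap]

/-- The point `η_{α,r}` of the line. -/
def discPoint (α : AlgebraicClosure k) (r : ℝ) (hr : 0 < r) : AffineLine k :=
  haveI h := gaussNorm_isAbsoluteValue (isNonarchimedean_spectralAbs (k := k)) hr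
  ⟨{ toFun := fun P => (taylor α (P.map (algebraMap k (AlgebraicClosure k)))).gaussNorm
        (spectralAbs k) r
     map_zero' := by simp
     add_le' := fun P Q => by
      simpa only [Polynomial.map_add, map_add] using h.abv_add' _ _
     neg' := fun P => by
      rw [Polynomial.map_neg, map_neg]
      exact IsAbsoluteValue.abv_neg (gaussNorm (spectralAbs k) r) _
     map_one' := by
      rw [Polynomial.map_one, taylor_one, gaussNorm_C, map_one]
     map_mul' := fun P Q => by
      rw [Polynomial.map_mul, taylor_mul, h.abv_mul'] },
    fun a => by
      change (taylor α ((C a).map (algebraMap k (AlgebraicClosure k)))).gaussNorm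
        (spectralAbs k) r = ‖a‖
      rw [map_C, taylor_C, gaussNorm_C, spectralAbs_algebraMap]⟩

theorem isDiscPoint_discPoint (α : AlgebraicClosure k) (r : ℝ) (hr : 0 < r) :
    IsDiscPoint (discPoint α r hr) α r := fun _ =>
  (iSup_coeff_eq_gaussNorm (spectralAbs k) hr.le _).symm

end DiscPoint

/-! ### Conjugates -/

variable (k) in
/-- The conjugates of an element of the algebraic closure, with multiplicities. -/
def conjugates (γ : AlgebraicClosure k) : Multiset (AlgebraicClosure k) :=
  (minpoly k γ).aroots (AlgebraicClosure k)

theorem isIntegral_algebraicClosure (γ : AlgebraicClosure k) : IsIntegral k γ :=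
  (Algebra.IsAlgebraic.isAlgebraic (R := k) γ).isIntegral

theorem mem_conjugates {γ β : AlgebraicClosure k} :
    β ∈ conjugates k γ ↔ ∃ σ : Gal(AlgebraicClosure k/k), σ γ = β := by
  have hint := isIntegral_algebraicClosure γ
  rw [conjugates, mem_aroots, ← isConjRoot_iff_aeval_eq_zero hint, IsConjRoot.comm,
    isConjRoot_iff_exists_algEquiv]
  exact and_iff_right (minpoly.ne_zero hint)

theorem self_mem_conjugates (γ : AlgebraicClosure k) : γ ∈ conjugates k γ :=
  mem_conjugates.2 ⟨1, rfl⟩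

theorem aroots_map_algEquiv (σ : Gal(AlgebraicClosure k/k)) (P : k[X]) :
    (P.aroots (AlgebraicClosure k)).map σ = P.aroots (AlgebraicClosure k) := by
  have h := (IsAlgClosed.splits (P.map (algebraMap k (AlgebraicClosure k)))).roots_map
    (σ : AlgebraicClosure k →+* AlgebraicClosure k)
  rw [Polynomial.map_map] at h
  have hc : (σ : AlgebraicClosure k →+* AlgebraicClosure k).comp
      (algebraMap k (AlgebraicClosure k)) = algebraMap k (AlgebraicClosure k) := by
    ext a; simp
  rw [hc] at h
  exact h.symm

theorem card_conjugates (γ : AlgebraicClosure k) :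
    (conjugates k γ).card = (minpoly k γ).natDegree :=
  IsAlgClosed.card_aroots_eq_natDegree

theorem card_conjugates_pos (γ : AlgebraicClosure k) : 0 < (conjugates k γ).card :=
  Multiset.card_pos_iff_exists_mem.2 ⟨γ, self_mem_conjugates γ⟩

theorem conjugates_map_algEquiv (σ : Gal(AlgebraicClosure k/k)) (γ : AlgebraicClosure k) :
    (conjugates k γ).map σ = conjugates k γ :=
  aroots_map_algEquiv σ _

/-- Lets the infimum defining `δ` be taken over elements of the algebraic closure. -/
theorem exists_eq_minpoly {P : k[X]} (hm : P.Monic) (hP : Irreducible P) :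
    ∃ γ : AlgebraicClosure k, P = minpoly k γ := by
  obtain ⟨γ, hγ⟩ := IsAlgClosed.exists_aeval_eq_zero (AlgebraicClosure k) P hP.degree_pos.ne'
  exact ⟨γ, minpoly.eq_of_irreducible_of_monic hP hγ hm⟩

theorem AffineLine.eval_nonneg (x : AffineLine k) (P : k[X]) : 0 ≤ x.eval P :=
  apply_nonneg x.1 P

theorem AffineLine.ext {x y : AffineLine k} (h : ∀ P, x.eval P = y.eval P) : x = y :=
  Subtype.ext (MulRingSeminorm.ext h)

end

/-! ### Galois orbits of discs and the formula for `δ`. -/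

section

variable {k : Type*} [NormedField k] [IsUltrametricDist k] [CompleteSpace k]

/-! ### Products of distances to the roots of a polynomial -/

/-- The product of the distances `max (r, |α - β|)` of the disc of centre `α` and radius `r` to the
elements `β` of `s`. -/
def distProd (s : Multiset (AlgebraicClosure k)) (α : AlgebraicClosure k) (r : ℝ) : ℝ :=
  (s.map fun β => max r (spectralAbs k (α - β))).prod

theorem max_spectralAbs_nonneg (r : ℝ) (x : AlgebraicClosure k) : 0 ≤ max r (spectralAbs k x) :=
  le_max_of_le_right ((spectralAbs k).nonneg x)

theorem distProd_nonneg (s : Multiset (AlgebraicClosure k)) (α : AlgebraicClosure k) (r : ℝ) :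
    0 ≤ distProd s α r := by
  refine Multiset.prod_nonneg fun x hx => ?_
  obtain ⟨β, -, rfl⟩ := Multiset.mem_map.1 hx
  exact max_spectralAbs_nonneg _ _

theorem distProd_le_distProd {s : Multiset (AlgebraicClosure k)} {α β : AlgebraicClosure k}
    {r t : ℝ} (h : max r (spectralAbs k (α - β)) ≤ t) : distProd s α r ≤ distProd s β t := by
  refine Multiset.prod_map_le_prod_map₀ _ _ (fun γ _ => max_spectralAbs_nonneg _ _) fun γ _ => ?_
  rw [← max_spectralAbs_congr ((le_max_right _ _).trans h)]
  exact max_le_max_right _ ((le_max_left _ _).trans h)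

theorem distProd_mono (s : Multiset (AlgebraicClosure k)) (α : AlgebraicClosure k) {r t : ℝ}
    (hr : 0 ≤ r) (h : r ≤ t) : distProd s α r ≤ distProd s α t :=
  distProd_le_distProd (by simpa [hr] using h)

theorem distProd_congr {α β : AlgebraicClosure k} {r : ℝ} (h : spectralAbs k (α - β) ≤ r)
    (s : Multiset (AlgebraicClosure k)) : distProd s α r = distProd s β r := by
  simp only [distProd, max_spectralAbs_congr h]

theorem continuous_distProd (s : Multiset (AlgebraicClosure k)) (α : AlgebraicClosure k) :
    Continuous (distProd s α) :=
  continuous_multiset_prod s fun _ _ => continuous_id.max continuous_const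

theorem distProd_algEquiv {s : Multiset (AlgebraicClosure k)} {σ : Gal(AlgebraicClosure k/k)}
    (hs : s.map σ = s) (α : AlgebraicClosure k) (r : ℝ) :
    distProd s (σ α) r = distProd s α r := by
  conv_lhs => rw [← hs]
  simp only [distProd, Multiset.map_map, Function.comp_apply, ← map_sub, spectralAbs_algEquiv]

/-- The geometric mean of the distances of the disc of centre `α` and radius `r` to the
conjugates of `γ`. -/
def meanDist (α γ : AlgebraicClosure k) (r : ℝ) : ℝ :=
  distProd (conjugates k γ) α r ^ ((conjugates k γ).card : ℝ)⁻¹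

theorem meanDist_congr {α β : AlgebraicClosure k} {r : ℝ} (h : spectralAbs k (α - β) ≤ r)
    (γ : AlgebraicClosure k) : meanDist α γ r = meanDist β γ r := by
  rw [meanDist, meanDist, distProd_congr h]

theorem meanDist_algEquiv_left (σ : Gal(AlgebraicClosure k/k)) (α γ : AlgebraicClosure k) (r : ℝ) :
    meanDist (σ α) γ r = meanDist α γ r := by
  rw [meanDist, meanDist, distProd_algEquiv (conjugates_map_algEquiv σ γ)]

theorem prod_distProd_conjugates (α : AlgebraicClosure k) (γ : AlgebraicClosure k) (r : ℝ) :
    ((conjugates k α).map fun α' => distProd (conjugates k γ) α' r).prod =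
      distProd (conjugates k γ) α r ^ (conjugates k α).card := by
  have : (conjugates k α).map (fun α' => distProd (conjugates k γ) α' r) =
      (conjugates k α).map fun _ => distProd (conjugates k γ) α r := by
    refine Multiset.map_congr rfl fun α' h => ?_
    obtain ⟨σ, rfl⟩ := mem_conjugates.1 h
    exact distProd_algEquiv (aroots_map_algEquiv σ _) _ _
  rw [this, Multiset.map_const', Multiset.prod_replicate]

/-- The geometric mean of the distances of `α` to the conjugates of `γ` is also that of the
distances of `γ` to the conjugates of `α`. -/
theorem meanDist_comm (α γ : AlgebraicClosure k) (r : ℝ) : meanDist α γ r = meanDist γ α r := by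
  have hsymm : ((conjugates k γ).map fun γ' => distProd (conjugates k α) γ' r).prod =
      ((conjugates k α).map fun α' => distProd (conjugates k γ) α' r).prod := by
    simp only [distProd]
    rw [Multiset.prod_map_prod_map]
    simp only [fun a b => (spectralAbs k).map_sub a b]
  have hα := card_conjugates_pos α
  have hγ := card_conjugates_pos γ
  have h : distProd (conjugates k α) γ r ^ (conjugates k γ).card =
      distProd (conjugates k γ) α r ^ (conjugates k α).card := by
    rw [← prod_distProd_conjugates, ← prod_distProd_conjugates, hsymm]
  rw [meanDist, meanDist, ← Real.pow_rpow_inv_natCast (distProd_nonneg (conjugates k γ) α r) hα.ne',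
    ← h, ← Real.rpow_mul (pow_nonneg (distProd_nonneg _ _ _) _), mul_comm, Real.rpow_mul
    (pow_nonneg (distProd_nonneg _ _ _) _), Real.pow_rpow_inv_natCast (distProd_nonneg _ _ _) hγ.ne']

theorem continuous_meanDist (α γ : AlgebraicClosure k) : Continuous (meanDist α γ) :=
  (continuous_distProd _ _).rpow_const fun _ => Or.inr (by positivity)

/-! ### The mean diameter -/

/-- The value of `δ(x,x)` at `x = η_{α,t}`. -/
def meanDiam (α : AlgebraicClosure k) (t : ℝ) : ℝ := meanDist α α t

theorem meanDiam_zero (α : AlgebraicClosure k) : meanDiam α 0 = 0 := by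
  have h : distProd (conjugates k α) α 0 = 0 :=
    Multiset.prod_eq_zero (Multiset.mem_map.2 ⟨α, self_mem_conjugates α, by simp⟩)
  rw [meanDiam, meanDist, h, Real.zero_rpow]
  have := card_conjugates_pos α
  positivity

theorem le_meanDiam (α : AlgebraicClosure k) {t : ℝ} (ht : 0 ≤ t) : t ≤ meanDiam α t := by
  have hc := card_conjugates_pos α
  have h : t ^ (conjugates k α).card ≤ distProd (conjugates k α) α t := by
    have := Multiset.prod_map_le_prod_map₀ (s := conjugates k α) (fun _ => t)
      (fun β => max t (spectralAbs k (α - β))) (fun _ _ => ht) (fun _ _ => le_max_left _ _)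
    rwa [Multiset.map_const', Multiset.prod_replicate] at this
  have h2 := Real.rpow_le_rpow (by positivity) h
    (show (0 : ℝ) ≤ ((conjugates k α).card : ℝ)⁻¹ by positivity)
  rwa [Real.pow_rpow_inv_natCast ht hc.ne'] at h2

/-- The factor of `α` itself is the radius, which increases strictly; the other factors do not
decrease and are positive at the larger radius. -/
theorem meanDiam_strictMonoOn (α : AlgebraicClosure k) :
    StrictMonoOn (meanDiam α) (Set.Ici 0) := by
  intro r hr t _ hrt
  have hr0 : (0 : ℝ) ≤ r := hr
  have hc := card_conjugates_pos α
  refine Real.rpow_lt_rpow (distProd_nonneg _ _ _) ?_ (by positivity)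
  obtain ⟨s, hs⟩ := Multiset.exists_cons_of_mem (self_mem_conjugates α)
  rw [hs]
  have hpos : 0 < distProd s α t := by
    refine Multiset.prod_pos fun x hx => ?_
    obtain ⟨β, -, rfl⟩ := Multiset.mem_map.1 hx
    exact lt_max_of_lt_left (hr0.trans_lt hrt)
  have hle := distProd_mono s α hr0 hrt.le
  simp only [distProd, Multiset.map_cons, Multiset.prod_cons, sub_self, map_zero] at hle hpos ⊢
  rw [max_eq_left hr0, max_eq_left (hr0.trans hrt.le)]
  calc _ ≤ r * _ := mul_le_mul_of_nonneg_left hle hr0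
    _ < _ := mul_lt_mul_of_pos_right hrt hpos

theorem meanDiam_le_iff (α : AlgebraicClosure k) {r t : ℝ} (hr : 0 ≤ r) (ht : 0 ≤ t) :
    meanDiam α r ≤ meanDiam α t ↔ r ≤ t :=
  (meanDiam_strictMonoOn α).le_iff_le hr ht

theorem meanDiam_pos (α : AlgebraicClosure k) {t : ℝ} (ht : 0 < t) : 0 < meanDiam α t :=
  ht.trans_le (le_meanDiam α ht.le)

theorem continuous_meanDiam (α : AlgebraicClosure k) : Continuous (meanDiam α) :=
  continuous_meanDist α α

theorem exists_meanDiam_eq (α : AlgebraicClosure k) {c : ℝ} (hc : 0 ≤ c) :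
    ∃ t, 0 ≤ t ∧ meanDiam α t = c := by
  obtain ⟨t, ht, h⟩ := intermediate_value_Icc hc (continuous_meanDiam α).continuousOn
    ⟨(meanDiam_zero α).trans_le hc, le_meanDiam α hc⟩
  exact ⟨t, ht.1, h⟩

/-! ### The distance of Galois orbits -/

/-- The distance of the Galois orbits of `α` and `β`. -/
def orbitDist (α β : AlgebraicClosure k) : ℝ :=
  ⨅ σ : Gal(AlgebraicClosure k/k), spectralAbs k (α - σ β)

theorem orbitDist_le (α β : AlgebraicClosure k) (σ : Gal(AlgebraicClosure k/k)) :
    orbitDist α β ≤ spectralAbs k (α - σ β) :=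
  ciInf_le ⟨0, by rintro _ ⟨τ, rfl⟩; exact (spectralAbs k).nonneg _⟩ σ

theorem exists_orbitDist_eq (α β : AlgebraicClosure k) :
    ∃ σ : Gal(AlgebraicClosure k/k), spectralAbs k (α - σ β) = orbitDist α β := by
  have hfin : (Set.range fun σ : Gal(AlgebraicClosure k/k) => spectralAbs k (α - σ β)).Finite := by
    refine ((conjugates k β).map fun γ => spectralAbs k (α - γ)).toFinset.finite_toSet.subset ?_
    rintro _ ⟨σ, rfl⟩
    simp only [Finset.mem_coe, Multiset.mem_toFinset, Multiset.mem_map]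
    exact ⟨σ β, mem_conjugates.2 ⟨σ, rfl⟩, rfl⟩
  exact (Set.range_nonempty _).csInf_mem hfin

theorem orbitDist_nonneg (α β : AlgebraicClosure k) : 0 ≤ orbitDist α β :=
  Real.iInf_nonneg fun _ => (spectralAbs k).nonneg _

theorem orbitDist_self (α : AlgebraicClosure k) : orbitDist α α = 0 :=
  le_antisymm ((orbitDist_le α α 1).trans (by simp)) (orbitDist_nonneg α α)

theorem orbitDist_comm (α β : AlgebraicClosure k) : orbitDist α β = orbitDist β α := by
  have h : ∀ α β : AlgebraicClosure k, orbitDist β α ≤ orbitDist α β := fun α β => by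
    obtain ⟨σ, hσ⟩ := exists_orbitDist_eq α β
    have h := orbitDist_le β α σ⁻¹
    rwa [← spectralAbs_algEquiv σ, map_sub, ← AlgEquiv.mul_apply, mul_inv_cancel,
      AlgEquiv.one_apply, (spectralAbs k).map_sub, hσ] at h
  exact le_antisymm (h _ _) (h _ _)

theorem orbitDist_le_max (α β γ : AlgebraicClosure k) :
    orbitDist α γ ≤ max (orbitDist α β) (orbitDist β γ) := by
  obtain ⟨σ, hσ⟩ := exists_orbitDist_eq α β
  obtain ⟨τ, hτ⟩ := exists_orbitDist_eq β γ
  have h : spectralAbs k (σ β - (σ * τ) γ) = orbitDist β γ := by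
    rw [← hτ, ← spectralAbs_algEquiv σ (β - τ γ)]
    simp
  rw [← hσ, ← h]
  exact (orbitDist_le α γ (σ * τ)).trans (spectralAbs_sub_le α (σ β) _)

/-- Every conjugate of `γ` is at distance at least `orbitDist α γ` from `α`, so raising the radius
to that value changes no factor. The enlarged disc contains a conjugate of `γ`, which may replace
`α` as its centre. -/
theorem meanDist_eq_meanDiam (α γ : AlgebraicClosure k) (r : ℝ) :
    meanDist α γ r = meanDiam γ (max r (orbitDist α γ)) := by
  obtain ⟨σ, hσ⟩ := exists_orbitDist_eq α γ
  have hle : spectralAbs k (α - σ γ) ≤ max r (orbitDist α γ) := hσ.trans_le (le_max_right _ _)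
  rw [meanDiam, ← meanDist_algEquiv_left σ γ, ← meanDist_congr hle, meanDist, meanDist,
    distProd, distProd]
  refine congrArg (fun s : Multiset ℝ => s.prod ^ _) (Multiset.map_congr rfl fun β hβ => ?_)
  obtain ⟨τ, rfl⟩ := mem_conjugates.1 hβ
  rw [max_assoc, max_eq_right (orbitDist_le α γ τ)]

/-- Both sides are the mean distance between the orbits of `α` and `β` at radius `t`, which is
symmetric by `meanDist_comm`. -/
theorem meanDiam_congr {α β : AlgebraicClosure k} {t : ℝ} (h : orbitDist α β ≤ t) :
    meanDiam α t = meanDiam β t := by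
  have h1 := meanDist_eq_meanDiam α β t
  have h2 := meanDist_eq_meanDiam β α t
  rw [orbitDist_comm, max_eq_left h] at h2
  rw [max_eq_left h] at h1
  rw [← h1, ← h2, meanDist_comm]

/-! ### Disc points -/

theorem IsDiscPoint.eval_eq {x : AffineLine k} {α : AlgebraicClosure k} {r : ℝ}
    (h : IsDiscPoint x α r) (hr : 0 < r) (P : k[X]) :
    x.eval P = ‖P.leadingCoeff‖ * distProd (P.aroots (AlgebraicClosure k)) α r :=
  (isDiscPoint_iff hr).1 h P

theorem IsDiscPoint.eval_minpoly {x : AffineLine k} {α : AlgebraicClosure k} {r : ℝ}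
    (h : IsDiscPoint x α r) (hr : 0 < r) (γ : AlgebraicClosure k) :
    x.eval (minpoly k γ) ^ (((minpoly k γ).natDegree : ℝ)⁻¹) =
      meanDiam γ (max r (orbitDist α γ)) := by
  rw [h.eval_eq hr, minpoly.monic (isIntegral_algebraicClosure γ), norm_one, one_mul,
    ← card_conjugates, ← meanDist_eq_meanDiam]
  rfl

/-- The order of the line in terms of discs. -/
theorem IsDiscPoint.le_iff {x y : AffineLine k} {α β : AlgebraicClosure k} {r s : ℝ}
    (hx : IsDiscPoint x α r) (hr : 0 < r) (hy : IsDiscPoint y β s) (hs : 0 < s) :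
    x ≤ y ↔ max r (orbitDist α β) ≤ s := by
  constructor
  · intro h
    -- The single test polynomial `minpoly k β` already forces the inclusion of discs up to
    -- conjugation.
    have h1 := Real.rpow_le_rpow (x.eval_nonneg _) (h (minpoly k β))
      (show (0 : ℝ) ≤ ((minpoly k β).natDegree : ℝ)⁻¹ by positivity)
    rwa [hx.eval_minpoly hr, hy.eval_minpoly hs, orbitDist_self, max_eq_left hs.le,
      meanDiam_le_iff β (hr.le.trans (le_max_left _ _)) hs.le] at h1
  · intro h P
    obtain ⟨σ, hσ⟩ := exists_orbitDist_eq α β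
    rw [hx.eval_eq hr, hy.eval_eq hs, ← distProd_algEquiv (aroots_map_algEquiv σ P) β]
    exact mul_le_mul_of_nonneg_left (distProd_le_distProd (hσ ▸ h)) (norm_nonneg _)

/-- The value of the kernel `δ` at points of type 2 or 3. -/
theorem IsDiscPoint.kernel_eq {x y : AffineLine k} {α β : AlgebraicClosure k} {r s : ℝ}
    (hx : IsDiscPoint x α r) (hr : 0 < r) (hy : IsDiscPoint y β s) (hs : 0 < s) :
    kernel x y = meanDiam β (max (max r s) (orbitDist α β)) := by
  have hmax : ∀ γ : AlgebraicClosure k,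
      max (x.eval (minpoly k γ)) (y.eval (minpoly k γ)) ^ (((minpoly k γ).natDegree : ℝ)⁻¹) =
        meanDiam γ (max (max r (orbitDist α γ)) (max s (orbitDist β γ))) := by
    intro γ
    have hmono : MonotoneOn (fun t : ℝ => t ^ (((minpoly k γ).natDegree : ℝ)⁻¹)) (Set.Ici 0) :=
      fun a ha b _ hab => Real.rpow_le_rpow ha hab (by positivity)
    have h1 := hmono.map_max (x.eval_nonneg (minpoly k γ)) (y.eval_nonneg (minpoly k γ))
    have h2 := (meanDiam_strictMonoOn γ).monotoneOn.map_max
      (a := max r (orbitDist α γ)) (b := max s (orbitDist β γ))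
      (hr.le.trans (le_max_left _ _)) (hs.le.trans (le_max_left _ _))
    rw [h1, h2, hx.eval_minpoly hr, hy.eval_minpoly hs]
  have hβ : Irreducible (minpoly k β) := minpoly.irreducible (isIntegral_algebraicClosure β)
  have hβm : (minpoly k β).Monic := minpoly.monic (isIntegral_algebraicClosure β)
  have : Nonempty {P : k[X] // P.Monic ∧ Irreducible P} := ⟨⟨minpoly k β, hβm, hβ⟩⟩
  apply le_antisymm
  -- The infimum is attained at the minimal polynomial of `β`.
  · refine (ciInf_le ⟨0, ?_⟩ ⟨minpoly k β, hβm, hβ⟩).trans ?_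
    · rintro _ ⟨P, rfl⟩
      exact Real.rpow_nonneg (le_max_of_le_left (x.eval_nonneg _)) _
    · rw [hmax, orbitDist_self, max_eq_left hs.le, max_right_comm]
  · refine le_ciInf fun P => ?_
    obtain ⟨γ, hγ⟩ := exists_eq_minpoly P.2.1 P.2.2
    rw [hγ, hmax]
    -- For another `γ`, the radius `T` reaches the orbit of `γ` from both centres, so the diameters
    -- of radius `T` about `γ` and `β` agree and it remains to compare radii.
    set T := max (max r (orbitDist α γ)) (max s (orbitDist β γ)) with hT
    have hβγ : orbitDist β γ ≤ T := (le_max_right _ _).trans (le_max_right _ _)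
    have hαγ : orbitDist α γ ≤ T := (le_max_right _ _).trans (le_max_left _ _)
    have hrT : r ≤ T := (le_max_left _ _).trans (le_max_left _ _)
    have hsT : s ≤ T := (le_max_left _ _).trans (le_max_right _ _)
    rw [← meanDiam_congr hβγ, meanDiam_le_iff]
    · refine max_le (max_le hrT hsT) ((orbitDist_le_max α γ β).trans (max_le hαγ ?_))
      rwa [orbitDist_comm]
    · exact (orbitDist_nonneg α β).trans (le_max_right _ _)
    · exact hr.le.trans hrT

end

/-! ### The tree metric on the points of type 2 or 3. -/

section

variable {k : Type*} [NormedField k]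

/-! ### The kernel on the points of type 2 or 3 -/

/-- The logarithm of the kernel `δ`. -/
abbrev gromov (x y : AffineLine k) : ℝ := Real.log (kernel x y)

theorem kernel_comm (x y : AffineLine k) : kernel x y = kernel y x := by
  simp only [kernel, max_comm]

theorem gromov_comm (x y : AffineLine k) : gromov x y = gromov y x := by
  rw [gromov, kernel_comm]

theorem AffineLine.le_antisymm {x y : AffineLine k} (hxy : x ≤ y) (hyx : y ≤ x) : x = y :=
  AffineLine.ext fun P => (hxy P).antisymm (hyx P)

theorem len_eq (x y : AffineLine k) : len x y = 2 * gromov x y - gromov x x - gromov y y := rfl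

theorem len_comm (x y : AffineLine k) : len x y = len y x := by
  rw [len_eq, len_eq, gromov_comm x y]; ring

theorem len_self (x : AffineLine k) : len x x = 0 := by
  rw [len_eq]; ring

theorem Fit.inter_eq_of_mem {I J : Set (AffineLine k)} (h : Fit I J) {z : AffineLine k}
    (hI : z ∈ I) (hJ : z ∈ J) : I ∩ J = {z} := by
  obtain ⟨⟨w, hw⟩, -⟩ := h
  have : z ∈ I ∩ J := ⟨hI, hJ⟩
  rw [hw, Set.mem_singleton_iff] at this
  rw [hw, this]

variable [IsUltrametricDist k] [CompleteSpace k]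

theorem IsType23.kernel_pos {x y : AffineLine k} (hx : IsType23 x) (hy : IsType23 y) :
    0 < kernel x y := by
  obtain ⟨α, r, hr, hx⟩ := hx
  obtain ⟨β, s, hs, hy⟩ := hy
  rw [hx.kernel_eq hr hy hs]
  exact meanDiam_pos _ (lt_max_of_lt_left (lt_max_of_lt_left hr))

theorem IsType23.kernel_le_max {x y z : AffineLine k} (hx : IsType23 x) (hy : IsType23 y)
    (hz : IsType23 z) : kernel x z ≤ max (kernel x y) (kernel y z) := by
  obtain ⟨α, r, hr, hx⟩ := hx
  obtain ⟨β, s, hs, hy⟩ := hy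
  obtain ⟨γ, t, ht, hz⟩ := hz
  have h : max (max r t) (orbitDist α γ) ≤
      max (max (max r s) (orbitDist α β)) (max (max s t) (orbitDist β γ)) := by
    have := orbitDist_le_max α β γ
    grind
  rw [kernel_comm x y, hx.kernel_eq hr hz ht, hy.kernel_eq hs hx hr, hy.kernel_eq hs hz ht,
    orbitDist_comm β α, max_comm s r]
  have h0 : 0 ≤ max (max r t) (orbitDist α γ) := hr.le.trans (by simp)
  rcases le_max_iff.1 h with h | h
  · refine le_max_of_le_left ?_
    rw [← meanDiam_congr (le_max_right (max r t) (orbitDist α γ)),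
      meanDiam_le_iff _ h0 (h0.trans h)]
    exact h
  · refine le_max_of_le_right ?_
    rwa [meanDiam_le_iff _ h0 (h0.trans h)]

theorem IsType23.gromov_le_max {x y z : AffineLine k} (hx : IsType23 x) (hy : IsType23 y)
    (hz : IsType23 z) : gromov x z ≤ max (gromov x y) (gromov y z) := by
  rcases le_max_iff.1 (hx.kernel_le_max hy hz) with h | h
  · exact le_max_of_le_left (Real.log_le_log (hx.kernel_pos hz) h)
  · exact le_max_of_le_right (Real.log_le_log (hx.kernel_pos hz) h)

theorem IsType23.gromov_self_le {x y : AffineLine k} (hx : IsType23 x) (hy : IsType23 y) :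
    gromov x x ≤ gromov x y := by
  simpa [gromov_comm y x] using hx.gromov_le_max hy hx

/-- Recovers the order from `δ` alone; the later arguments about the metric then need discs only
through the rays of `IsType23.exists_ray`. -/
theorem IsType23.le_iff {x y : AffineLine k} (hx : IsType23 x) (hy : IsType23 y) :
    x ≤ y ↔ gromov x y = gromov y y := by
  have hxy := hx.kernel_pos hy
  have hyy := hy.kernel_pos hy
  rw [gromov, gromov, Real.log_injOn_pos.eq_iff hxy hyy]
  obtain ⟨α, r, hr, hx⟩ := hx
  obtain ⟨β, s, hs, hy⟩ := hy
  rw [hx.le_iff hr hy hs, hx.kernel_eq hr hy hs, hy.kernel_eq hs hy hs, orbitDist_self, max_self,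
    max_eq_left hs.le, (meanDiam_strictMonoOn β).injOn.eq_iff]
  · constructor
    · intro h
      rw [max_right_comm, max_eq_right h]
    · intro h
      rw [← h, max_right_comm]
      exact le_max_left _ _
  · exact (hr.le.trans (le_max_left _ _)).trans (le_max_left _ _)
  · exact hs.le

/-- The ray of discs about a centre of `x`, reparametrized by `log δ` on the diagonal. -/
theorem IsType23.exists_ray {x : AffineLine k} (hx : IsType23 x) :
    ∃ f : ℝ → AffineLine k, Continuous f ∧ ∀ c, IsType23 (f c) ∧ gromov (f c) (f c) = c ∧
      (gromov x x ≤ c → x ≤ f c) := by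
  obtain ⟨α, r, hr, hx⟩ := hx
  have hmono : StrictMono fun u : ℝ => Real.log (meanDiam α (Real.exp u)) := fun u v huv =>
    Real.log_lt_log (meanDiam_pos α (Real.exp_pos u))
      (meanDiam_strictMonoOn α (Real.exp_pos u).le (Real.exp_pos v).le (Real.exp_lt_exp.2 huv))
  have hsurj : Function.Surjective fun u : ℝ => Real.log (meanDiam α (Real.exp u)) := by
    intro c
    obtain ⟨t, ht, h⟩ := exists_meanDiam_eq α (Real.exp_pos c).le
    have ht : 0 < t := by
      refine ht.lt_of_ne' ?_
      rintro rfl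
      rw [meanDiam_zero] at h
      exact (Real.exp_pos c).ne h
    refine ⟨Real.log t, ?_⟩
    simp only [Real.exp_log ht, h, Real.log_exp]
  -- An increasing bijection of `ℝ` is an order isomorphism, so its inverse is continuous.
  let e := hmono.orderIsoOfSurjective _ hsurj
  have he : ∀ c, Real.log (meanDiam α (Real.exp (e.symm c))) = c := e.apply_symm_apply
  have hf := fun c => isDiscPoint_discPoint α (Real.exp (e.symm c)) (Real.exp_pos _)
  have hg : ∀ c, gromov (discPoint α (Real.exp (e.symm c)) (Real.exp_pos _))
      (discPoint α (Real.exp (e.symm c)) (Real.exp_pos _)) = c := fun c => by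
    rw [gromov, (hf c).kernel_eq (Real.exp_pos _) (hf c) (Real.exp_pos _), orbitDist_self, max_self,
      max_eq_left (Real.exp_pos _).le, he]
  refine ⟨fun c => discPoint α (Real.exp (e.symm c)) (Real.exp_pos _), ?_, fun c =>
    ⟨⟨α, _, Real.exp_pos _, hf c⟩, hg c, fun h => ?_⟩⟩
  · refine continuous_induced_rng.2 (continuous_pi fun P => ?_)
    simp only [Function.comp_apply, fun c => (hf c).eval_eq (Real.exp_pos _) P]
    exact continuous_const.mul ((continuous_distProd _ α).comp
      (Real.continuous_exp.comp e.symm.continuous))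
  · rw [hx.le_iff hr (hf c) (Real.exp_pos _), orbitDist_self, max_eq_left hr.le,
      ← meanDiam_le_iff α hr.le (Real.exp_pos _).le]
    rw [gromov, hx.kernel_eq hr hx hr, orbitDist_self, max_self, max_eq_left hr.le, ← he c] at h
    exact (Real.log_le_log_iff (meanDiam_pos α hr) (meanDiam_pos α (Real.exp_pos _))).1 h

/-! ### The tree metric -/

theorem IsType23.len_nonneg {x y : AffineLine k} (hx : IsType23 x) (hy : IsType23 y) :
    0 ≤ len x y := by
  have h1 := hx.gromov_self_le hy
  have h2 := hy.gromov_self_le hx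
  rw [gromov_comm y x] at h2
  rw [len_eq]
  linarith

theorem IsType23.eq_of_len_eq_zero {x y : AffineLine k} (hx : IsType23 x) (hy : IsType23 y)
    (h : len x y = 0) : x = y := by
  have h1 := hx.gromov_self_le hy
  have h2 := hy.gromov_self_le hx
  rw [len_eq] at h
  rw [gromov_comm y x] at h2
  refine AffineLine.le_antisymm ((hx.le_iff hy).2 (by linarith)) ((hy.le_iff hx).2 ?_)
  rw [gromov_comm y x]
  linarith

/-- The diagonal terms are the same in all three sums, so this is the four-point inequality for `log
δ`, a consequence of the ultrametric one. -/
theorem IsType23.four_point {x y z w : AffineLine k} (hx : IsType23 x) (hy : IsType23 y)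
    (hz : IsType23 z) (hw : IsType23 w) :
    len x y + len z w ≤ max (len x z + len y w) (len x w + len y z) := by
  have h1 := hx.gromov_le_max hz hy
  have h2 := hx.gromov_le_max hw hy
  have h3 := hz.gromov_le_max hx hw
  have h4 := hz.gromov_le_max hy hw
  rw [gromov_comm z x] at h3
  rw [gromov_comm z y] at h1 h4
  rw [gromov_comm w y] at h2
  simp only [len_eq]
  rcases le_max_iff.1 h1 with h1 | h1 <;> rcases le_max_iff.1 h2 with h2 | h2 <;>
  rcases le_max_iff.1 h3 with h3 | h3 <;> rcases le_max_iff.1 h4 with h4 | h4 <;>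
  first
  | exact le_max_of_le_left (by linarith)
  | exact le_max_of_le_right (by linarith)
  -- In the mixed cases the left side is bounded only by the average of the two sums, hence by the
  -- larger one.
  | (rcases le_total (gromov x z + gromov y w) (gromov x w + gromov y z) with h | h
     · exact le_max_of_le_right (by linarith)
     · exact le_max_of_le_left (by linarith))

theorem IsType23.len_triangle {x y z : AffineLine k} (hx : IsType23 x) (hy : IsType23 y)
    (hz : IsType23 z) : len x z ≤ len x y + len y z := by
  have h := hx.four_point hz hy hy
  rw [len_self, len_comm z y] at h
  simpa using h

theorem IsType23.abs_gromov_self_sub_le {x y : AffineLine k} (hx : IsType23 x) (hy : IsType23 y) :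
    |gromov x x - gromov y y| ≤ len x y := by
  have h1 := hx.gromov_self_le hy
  have h2 := hy.gromov_self_le hx
  rw [gromov_comm y x] at h2
  rw [len_eq, abs_le]
  constructor <;> linarith

/-- A point above both `x` and `y` at the level of `δ(x,y)`. -/
theorem IsType23.exists_join {x y : AffineLine k} (hx : IsType23 x) (hy : IsType23 y) :
    ∃ z, IsType23 z ∧ x ≤ z ∧ y ≤ z ∧ gromov z z = gromov x y := by
  obtain ⟨f, -, hf⟩ := hx.exists_ray
  obtain ⟨hz, hzz, hxz⟩ := hf (gromov x y)
  have hxz := hxz (hx.gromov_self_le hy)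
  refine ⟨f (gromov x y), hz, hxz, ?_, hzz⟩
  rw [hy.le_iff hz]
  rw [hx.le_iff hz] at hxz
  have h1 := hy.gromov_le_max hx hz
  have h2 := hz.gromov_self_le hy
  rw [gromov_comm (f _) y] at h2
  rw [hxz, hzz, gromov_comm y x, max_self] at h1
  exact le_antisymm (by rw [hzz]; exact h1) h2

/-- The segments are those of the metric. -/
theorem IsType23.mem_seg_iff {x y z : AffineLine k} (hx : IsType23 x) (hy : IsType23 y) :
    z ∈ seg x y ↔ IsType23 z ∧ len x z + len z y = len x y := by
  refine and_congr_right fun hz => ?_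
  have hxz := hz.gromov_self_le hx
  have hyz := hz.gromov_self_le hy
  have hxy := hx.gromov_le_max hz hy
  simp only [len_eq]
  rw [gromov_comm z x] at hxz
  constructor
  · rintro ⟨h, hle⟩
    obtain ⟨j, hj, hxj, hyj, hjj⟩ := hx.exists_join hy
    have hzj := hle j hj hxj hyj
    rw [hx.le_iff hj, hjj] at hxj
    rw [hy.le_iff hj, hjj] at hyj
    rw [hz.le_iff hj, hjj] at hzj
    have h1 := hz.gromov_le_max hj hy
    have h2 := hx.gromov_le_max hj hz
    rw [gromov_comm j y, hyj, hzj, max_self] at h1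
    rw [gromov_comm j z, hxj, hzj, max_self] at h2
    rcases h with h | h
    · rw [hx.le_iff hz] at h
      rw [h, max_eq_right hyz] at hxy
      linarith
    · rw [hy.le_iff hz, gromov_comm y z] at h
      rw [h, max_eq_left hxz] at hxy
      linarith
  -- Additivity of lengths means `gromov x z + gromov z y = gromov x y + gromov z z`. With the
  -- ultrametric inequality, one term on the left equals `gromov z z`, so `z` is above `x` or `y`.
  · intro h
    rcases le_max_iff.1 hxy with h1 | h1
    · have h2 : gromov z y = gromov z z := by linarith
      refine ⟨Or.inr ((hy.le_iff hz).2 (by rw [gromov_comm y z, h2])), fun w hw hxw hyw => ?_⟩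
      rw [hx.le_iff hw] at hxw
      rw [hy.le_iff hw] at hyw
      rw [hz.le_iff hw]
      have h3 := hw.gromov_self_le hz
      have h4 := hz.gromov_le_max hy hw
      have h5 := hx.gromov_le_max hw hy
      have h6 := hw.gromov_self_le hy
      rw [gromov_comm w z] at h3
      rw [gromov_comm w y, hxw, hyw, max_self] at h5
      rw [hyw, h2, max_eq_right (by linarith)] at h4
      linarith
    · have h2 : gromov x z = gromov z z := by linarith
      refine ⟨Or.inl ((hx.le_iff hz).2 h2), fun w hw hxw hyw => ?_⟩
      rw [hx.le_iff hw] at hxw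
      rw [hy.le_iff hw] at hyw
      rw [hz.le_iff hw]
      have h3 := hw.gromov_self_le hz
      have h4 := hz.gromov_le_max hx hw
      have h5 := hx.gromov_le_max hw hy
      rw [gromov_comm w z] at h3
      rw [gromov_comm w y, hxw, hyw, max_self] at h5
      rw [hxw, gromov_comm z x, h2, max_eq_right (by linarith)] at h4
      linarith

theorem IsType23.seg_comm {x y : AffineLine k} (hx : IsType23 x) (hy : IsType23 y) :
    seg x y = seg y x := by
  ext z
  rw [hx.mem_seg_iff hy, hy.mem_seg_iff hx, len_comm x y, len_comm x z, len_comm z y, add_comm]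

theorem IsType23.left_mem_seg {x y : AffineLine k} (hx : IsType23 x) (hy : IsType23 y) :
    x ∈ seg x y := by
  rw [hx.mem_seg_iff hy, len_self, zero_add]
  exact ⟨hx, rfl⟩

theorem IsType23.right_mem_seg {x y : AffineLine k} (hx : IsType23 x) (hy : IsType23 y) :
    y ∈ seg x y := by
  rw [hx.mem_seg_iff hy, len_self, add_zero]
  exact ⟨hy, rfl⟩

/-- The distance of points of a segment in terms of their distances to an end point. -/
theorem IsType23.len_eq_abs_sub {x y z w : AffineLine k} (hx : IsType23 x) (hy : IsType23 y)
    (hz : z ∈ seg x y) (hw : w ∈ seg x y) : len z w = |len x z - len x w| := by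
  rw [hx.mem_seg_iff hy] at hz hw
  obtain ⟨hz, hz'⟩ := hz
  obtain ⟨hw, hw'⟩ := hw
  have h := hz.four_point hw hx hy
  have h1 := hx.len_triangle hz hw
  have h2 := hx.len_triangle hw hz
  rw [len_comm w z] at h2
  rw [len_comm z x, len_comm w x] at h
  apply le_antisymm
  · rcases le_max_iff.1 h with h | h
    · exact le_trans (by linarith) (le_abs_self _)
    · exact le_trans (by linarith) (neg_le_abs _)
  · rw [abs_le]
    constructor <;> linarith

theorem IsType23.eq_of_mem_seg {x y z w : AffineLine k} (hx : IsType23 x) (hy : IsType23 y)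
    (hz : z ∈ seg x y) (hw : w ∈ seg x y) (h : len x z = len x w) : z = w :=
  hz.1.eq_of_len_eq_zero hw.1 (by rw [hx.len_eq_abs_sub hy hz hw, h, sub_self, abs_zero])

theorem IsType23.mem_seg_of_le {x y z : AffineLine k} (hx : IsType23 x) (hy : IsType23 y)
    (hz : IsType23 z) (hxz : x ≤ z) (h : gromov z z ≤ gromov x y) :
    z ∈ seg x y ∧ len x z = gromov z z - gromov x x := by
  rw [hx.le_iff hz] at hxz
  have h1 := hz.gromov_le_max hx hy
  have h2 := hx.gromov_le_max hz hy
  have h3 := hz.gromov_self_le hy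
  rw [gromov_comm z x, hxz, max_eq_right h] at h1
  rw [hxz, max_eq_right h3] at h2
  rw [hx.mem_seg_iff hy, len_eq, len_eq, len_eq]
  exact ⟨⟨hz, by linarith⟩, by linarith⟩

/-- The continuous parametrization of a segment by the distance to an end point. -/
theorem IsType23.exists_param {x y : AffineLine k} (hx : IsType23 x) (hy : IsType23 y) :
    ∃ f : ℝ → AffineLine k, Continuous f ∧
      ∀ t ∈ Set.Icc 0 (len x y), f t ∈ seg x y ∧ len x (f t) = t := by
  obtain ⟨f, hfc, hf⟩ := hx.exists_ray
  obtain ⟨g, hgc, hg⟩ := hy.exists_ray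
  have hxy := hx.gromov_self_le hy
  have hyx := hy.gromov_self_le hx
  have hl := len_eq x y
  rw [gromov_comm y x] at hyx
  have hleft : ∀ t, 0 ≤ t → t ≤ gromov x y - gromov x x →
      f (gromov x x + t) ∈ seg x y ∧ len x (f (gromov x x + t)) = t := by
    intro t h0 ht
    obtain ⟨h1, h2, h3⟩ := hf (gromov x x + t)
    obtain ⟨h4, h5⟩ := hx.mem_seg_of_le hy h1 (h3 (by linarith)) (by rw [h2]; linarith)
    exact ⟨h4, by rw [h5, h2]; ring⟩
  have hright : ∀ t, t ≤ len x y → gromov x y - gromov x x ≤ t →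
      g (gromov y y + (len x y - t)) ∈ seg x y ∧ len x (g (gromov y y + (len x y - t))) = t := by
    intro t h0 ht
    obtain ⟨h1, h2, h3⟩ := hg (gromov y y + (len x y - t))
    obtain ⟨h4, h5⟩ := hy.mem_seg_of_le hx h1 (h3 (by linarith))
      (by rw [h2, gromov_comm y x]; linarith)
    rw [hy.seg_comm hx] at h4
    refine ⟨h4, ?_⟩
    have h6 := ((hx.mem_seg_iff hy).1 h4).2
    rw [len_comm (g _) y, h5, h2] at h6
    linarith
  -- Climb from `x` to the level of the join, then descend along the ray of `y`; the two branches
  -- agree at the join because a point of the segment is determined by its distance to `x`.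
  refine ⟨fun t => if t ≤ gromov x y - gromov x x then f (gromov x x + t)
    else g (gromov y y + (len x y - t)), ?_, fun t ht => ?_⟩
  · refine Continuous.if_le (hfc.comp (by fun_prop)) (hgc.comp (by fun_prop)) continuous_id
      continuous_const fun t ht => ?_
    obtain ⟨h1, h2⟩ := hleft t (by rw [ht]; linarith) ht.le
    obtain ⟨h3, h4⟩ := hright t (by rw [ht]; linarith) ht.ge
    exact hx.eq_of_mem_seg hy h1 h3 (h2.trans h4.symm)
  · dsimp only
    split_ifs with h
    · exact hleft t ht.1 h
    · exact hright t ht.2 (not_le.1 h).le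

/-! ### Gates -/

theorem IsType23.exists_mem_seg_len_eq {x y : AffineLine k} (hx : IsType23 x) (hy : IsType23 y)
    {t : ℝ} (h0 : 0 ≤ t) (ht : t ≤ len x y) : ∃ z ∈ seg x y, len x z = t := by
  obtain ⟨f, -, hf⟩ := hx.exists_param hy
  exact ⟨f t, hf t ⟨h0, ht⟩⟩

/-- The projection of a point to a segment. -/
theorem IsType23.exists_gate {x y z : AffineLine k} (hx : IsType23 x) (hy : IsType23 y)
    (hz : IsType23 z) : ∃ p ∈ seg y z, ∀ c ∈ seg y z, p ∈ seg x c := by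
  have h1 := hy.len_triangle hx hz
  have h2 := hx.len_triangle hy hz
  have h3 := hx.len_triangle hz hy
  rw [len_comm z y] at h3
  rw [len_comm y x] at h1
  -- The distance from `y` to the gate is the Gromov product of `x` and `z` based at `y`. With this
  -- choice both terms of the maximum in the four-point inequality `h4` coincide.
  obtain ⟨p, hp, ht⟩ := hy.exists_mem_seg_len_eq hz
    (t := (len x y + len y z - len x z) / 2) (by linarith) (by linarith)
  refine ⟨p, hp, fun c hc => ?_⟩
  have hpc := hy.len_eq_abs_sub hz hp hc
  have hpz := ((hy.mem_seg_iff hz).1 hp).2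
  have hcz := ((hy.mem_seg_iff hz).1 hc).2
  have h4 := hx.four_point hp.1 hy hz
  have h5 := hx.len_triangle hp.1 hc.1
  have h6 := hx.len_triangle hc.1 hy
  have h7 := hx.len_triangle hc.1 hz
  rw [len_comm c y] at h6
  rw [len_comm p y] at h4
  have h8 : len x p ≤ len x y - len y p := by
    rcases le_max_iff.1 h4 with h4 | h4 <;> linarith
  refine (hx.mem_seg_iff hc.1).2 ⟨hp.1, le_antisymm ?_ h5⟩
  rcases abs_cases (len y p - len y c) with ⟨h, -⟩ | ⟨h, -⟩ <;> rw [hpc, h] <;> linarith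

end

/-! ### The configuration of two segments with a common point. -/

section

variable {k : Type*} [NormedField k] [IsUltrametricDist k] [CompleteSpace k]

/-! ### Subdivision of segments -/

theorem IsType23.seg_subset_left {x y p : AffineLine k} (hx : IsType23 x) (hy : IsType23 y)
    (hp : p ∈ seg x y) : seg x p ⊆ seg x y := by
  intro z hz
  have hz' := ((hx.mem_seg_iff hp.1).1 hz).2
  have hp' := ((hx.mem_seg_iff hy).1 hp).2
  have h1 := hz.1.len_triangle hp.1 hy
  have h2 := hx.len_triangle hz.1 hy
  exact (hx.mem_seg_iff hy).2 ⟨hz.1, by linarith⟩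

theorem IsType23.seg_subset_right {x y p : AffineLine k} (hx : IsType23 x) (hy : IsType23 y)
    (hp : p ∈ seg x y) : seg p y ⊆ seg x y := by
  rw [hx.seg_comm hy] at hp ⊢
  rw [hp.1.seg_comm hy]
  exact hy.seg_subset_left hx hp

theorem IsType23.mem_seg_left_of_len_le {x y p q : AffineLine k} (hx : IsType23 x)
    (hy : IsType23 y) (hp : p ∈ seg x y) (hq : q ∈ seg x y) (h : len x p ≤ len x q) :
    p ∈ seg x q := by
  refine (hx.mem_seg_iff hq.1).2 ⟨hp.1, ?_⟩
  rw [hx.len_eq_abs_sub hy hp hq, abs_of_nonpos (by linarith)]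
  ring

theorem IsType23.mem_seg_right_of_len_le {x y p q : AffineLine k} (hx : IsType23 x)
    (hy : IsType23 y) (hp : p ∈ seg x y) (hq : q ∈ seg x y) (h : len x p ≤ len x q) :
    q ∈ seg p y := by
  have hp' := ((hx.mem_seg_iff hy).1 hp).2
  have hq' := ((hx.mem_seg_iff hy).1 hq).2
  refine (hp.1.mem_seg_iff hy).2 ⟨hq.1, ?_⟩
  rw [hx.len_eq_abs_sub hy hp hq, abs_of_nonpos (by linarith)]
  linarith

theorem IsType23.seg_union {x y p : AffineLine k} (hx : IsType23 x) (hy : IsType23 y)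
    (hp : p ∈ seg x y) : seg x p ∪ seg p y = seg x y := by
  refine Set.Subset.antisymm
    (Set.union_subset (hx.seg_subset_left hy hp) (hx.seg_subset_right hy hp)) fun z hz => ?_
  rcases le_total (len x z) (len x p) with h | h
  · exact Or.inl (hx.mem_seg_left_of_len_le hy hz hp h)
  · exact Or.inr (hx.mem_seg_right_of_len_le hy hp hz h)

theorem IsType23.seg_inter {x y p : AffineLine k} (hx : IsType23 x) (hy : IsType23 y)
    (hp : p ∈ seg x y) : seg x p ∩ seg p y = {p} := by
  ext z
  simp only [Set.mem_inter_iff, Set.mem_singleton_iff]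
  constructor
  · rintro ⟨h1, h2⟩
    have h1' := ((hx.mem_seg_iff hp.1).1 h1).2
    have h2' := ((hp.1.mem_seg_iff hy).1 h2).2
    have hp' := ((hx.mem_seg_iff hy).1 hp).2
    have h3 := hx.len_triangle h1.1 hy
    have h4 := h1.1.len_nonneg hp.1
    rw [len_comm p z] at h2'
    exact h1.1.eq_of_len_eq_zero hp.1 (by linarith)
  · rintro rfl
    exact ⟨hx.right_mem_seg hp.1, hp.1.left_mem_seg hy⟩

theorem IsType23.fit {x y p : AffineLine k} (hx : IsType23 x) (hy : IsType23 y)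
    (hp : p ∈ seg x y) : Fit (seg x p) (seg p y) :=
  ⟨⟨p, hx.seg_inter hy hp⟩, x, y, hx, hy, hx.seg_union hy hp⟩

theorem IsType23.seg_subset {x y p q : AffineLine k} (hx : IsType23 x) (hy : IsType23 y)
    (hp : p ∈ seg x y) (hq : q ∈ seg x y) : seg p q ⊆ seg x y := by
  wlog h : len x p ≤ len x q generalizing p q
  · rw [hp.1.seg_comm hq.1]
    exact this hq hp (le_of_not_ge h)
  · exact (hp.1.seg_subset_left hy (hx.mem_seg_right_of_len_le hy hp hq h)).trans
      (hx.seg_subset_right hy hp)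

/-! ### Two segments with a common point -/

theorem meetAlong_of_len_le {a' a'' b' b'' p q : AffineLine k} (ha' : IsType23 a')
    (ha'' : IsType23 a'') (hb' : IsType23 b') (hb'' : IsType23 b'')
    (h : seg a' a'' ∩ seg b' b'' = seg p q) (hpa : p ∈ seg a' a'') (hqa : q ∈ seg a' a'')
    (hpb : p ∈ seg b' b'') (hqb : q ∈ seg b' b'') (ha : len a' p ≤ len a' q)
    (hb : len b' p ≤ len b' q) : MeetAlong a' a'' b' b'' p q where
  type_p := hpa.1
  type_q := hqa.1
  inter_eq := h
  a_eq := by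
    rw [ha'.seg_union hqa.1 (ha'.mem_seg_left_of_len_le ha'' hpa hqa ha), ha'.seg_union ha'' hqa]
  b_eq := by
    rw [hb'.seg_union hqb.1 (hb'.mem_seg_left_of_len_le hb'' hpb hqb hb), hb'.seg_union hb'' hqb]
  fit_a' := ha'.fit hqa.1 (ha'.mem_seg_left_of_len_le ha'' hpa hqa ha)
  fit_a'' := hpa.1.fit ha'' (ha'.mem_seg_right_of_len_le ha'' hpa hqa ha)
  fit_b' := hb'.fit hqb.1 (hb'.mem_seg_left_of_len_le hb'' hpb hqb hb)
  fit_b'' := hpb.1.fit hb'' (hb'.mem_seg_right_of_len_le hb'' hpb hqb hb)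

/-- The points `p` and `q` are the projections of `a'` and `a''` to `I_b`. They lie on `I_a` because
they lie on the segments from `a'` and `a''` to a common point `c`, and every common point is
between them. Their order along `I_b` decides the labelling of its ends. -/
theorem exists_meetAlong {a' a'' b' b'' : AffineLine k} (ha' : IsType23 a')
    (ha'' : IsType23 a'') (hb' : IsType23 b') (hb'' : IsType23 b'')
    (hne : (seg a' a'' ∩ seg b' b'').Nonempty) :
    ∃ p q, MeetAlong a' a'' b' b'' p q ∨ MeetAlong a' a'' b'' b' p q := by
  obtain ⟨c, hca, hcb⟩ := hne
  obtain ⟨p, hpb, hp⟩ := ha'.exists_gate hb' hb''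
  obtain ⟨q, hqb, hq⟩ := ha''.exists_gate hb' hb''
  have hpa : p ∈ seg a' a'' := ha'.seg_subset_left ha'' hca (hp c hcb)
  have hqa : q ∈ seg a' a'' := by
    rw [ha'.seg_comm ha''] at hca ⊢
    exact ha''.seg_subset_left ha' hca (hq c hcb)
  have hle : ∀ z ∈ seg a' a'' ∩ seg b' b'', len a' p ≤ len a' z ∧ len a' z ≤ len a' q := by
    rintro z ⟨hza, hzb⟩
    have h1 := ((ha'.mem_seg_iff hza.1).1 (hp z hzb)).2
    have h2 := ((ha''.mem_seg_iff hza.1).1 (hq z hzb)).2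
    have h3 := ((ha'.mem_seg_iff ha'').1 hza).2
    have h4 := ((ha'.mem_seg_iff ha'').1 hqa).2
    have h5 := hpa.1.len_nonneg hza.1
    have h6 := hqa.1.len_nonneg hza.1
    rw [len_comm a'' q, len_comm a'' z] at h2
    constructor <;> linarith
  have hinter : seg a' a'' ∩ seg b' b'' = seg p q := by
    refine Set.Subset.antisymm (fun z hz => ?_)
      (Set.subset_inter (ha'.seg_subset ha'' hpa hqa) (hb'.seg_subset hb'' hpb hqb))
    obtain ⟨h1, h2⟩ := hle z hz
    refine (hpa.1.mem_seg_iff hqa.1).2 ⟨hz.1.1, ?_⟩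
    rw [ha'.len_eq_abs_sub ha'' hpa hz.1, ha'.len_eq_abs_sub ha'' hz.1 hqa,
      ha'.len_eq_abs_sub ha'' hpa hqa, abs_of_nonpos (by linarith), abs_of_nonpos (by linarith),
      abs_of_nonpos (by linarith)]
    ring
  have ha : len a' p ≤ len a' q := (hle p ⟨hpa, hpb⟩).2
  refine ⟨p, q, (le_total (len b' p) (len b' q)).imp (fun hb => ?_) fun hb => ?_⟩
  · exact meetAlong_of_len_le ha' ha'' hb' hb'' hinter hpa hqa hpb hqb ha hb
  · have h1 := ((hb'.mem_seg_iff hb'').1 hpb).2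
    have h2 := ((hb'.mem_seg_iff hb'').1 hqb).2
    rw [hb'.seg_comm hb''] at hinter hpb hqb
    refine meetAlong_of_len_le ha' ha'' hb'' hb' hinter hpa hqa hpb hqb ha ?_
    rw [len_comm b'' p, len_comm b'' q]
    linarith

/-- If `q` came before `p`, it would lie in `[x,p] ∩ [p,q] = {p}`; so `Fit` forces the expected
order. -/
theorem len_add_of_fit {x y p q : AffineLine k} (hx : IsType23 x) (hy : IsType23 y)
    (hp : p ∈ seg x y) (hq : q ∈ seg x y) (h : Fit (seg x p) (seg p q)) :
    len x q = len x p + len p q := by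
  have hlen := hx.len_eq_abs_sub hy hp hq
  rcases le_total (len x p) (len x q) with hle | hle
  · rw [abs_of_nonpos (by linarith)] at hlen
    linarith
  · have hpp := h.inter_eq_of_mem (hx.right_mem_seg hp.1) (hp.1.left_mem_seg hq.1)
    have hqp : q ∈ seg x p ∩ seg p q :=
      ⟨hx.mem_seg_left_of_len_le hy hq hp hle, hp.1.right_mem_seg hq.1⟩
    rw [hpp, Set.mem_singleton_iff] at hqp
    rw [hqp, len_self, add_zero]

namespace MeetAlong

variable {a' a'' b' b'' p q : AffineLine k}

theorem p_mem (h : MeetAlong a' a'' b' b'' p q) : p ∈ seg a' a'' ∩ seg b' b'' :=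
  h.inter_eq ▸ h.type_p.left_mem_seg h.type_q

theorem q_mem (h : MeetAlong a' a'' b' b'' p q) : q ∈ seg a' a'' ∩ seg b' b'' :=
  h.inter_eq ▸ h.type_p.right_mem_seg h.type_q

theorem len_a'_q (h : MeetAlong a' a'' b' b'' p q) (ha' : IsType23 a') (ha'' : IsType23 a'') :
    len a' q = len a' p + len p q :=
  len_add_of_fit ha' ha'' h.p_mem.1 h.q_mem.1 h.fit_a'

theorem len_b'_q (h : MeetAlong a' a'' b' b'' p q) (hb' : IsType23 b') (hb'' : IsType23 b'') :
    len b' q = len b' p + len p q :=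
  len_add_of_fit hb' hb'' h.p_mem.2 h.q_mem.2 h.fit_b'

theorem len_a (h : MeetAlong a' a'' b' b'' p q) (ha' : IsType23 a') (ha'' : IsType23 a'') :
    len a' a'' = len a' p + len p q + len q a'' := by
  rw [← h.len_a'_q ha' ha'', ((ha'.mem_seg_iff ha'').1 h.q_mem.1).2]

theorem len_b (h : MeetAlong a' a'' b' b'' p q) (hb' : IsType23 b') (hb'' : IsType23 b'') :
    len b' b'' = len b' p + len p q + len q b'' := by
  rw [← h.len_b'_q hb' hb'', ((hb'.mem_seg_iff hb'').1 h.q_mem.2).2]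

/-- The points of `I_a` before `p` project to `p` on `I_b`. -/
theorem len_eq_of_le (h : MeetAlong a' a'' b' b'' p q) (ha' : IsType23 a') (ha'' : IsType23 a'')
    (hb' : IsType23 b') (hb'' : IsType23 b'') {z w : AffineLine k} (hz : z ∈ seg a' a'')
    (hw : w ∈ seg b' b'') (hle : len a' z ≤ len a' p) : len z w = len z p + len p w := by
  -- The gate `m` of `z` on `I_b` lies on `[z,p]`, hence in both `[a',p]` and `[p,q]`, which meet
  -- only in `p`.
  obtain ⟨m, hm, hgate⟩ := hz.1.exists_gate hb' hb''
  have hmz := hgate p h.p_mem.2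
  have hma : m ∈ seg a' p := ha'.seg_subset_right h.type_p
    (ha'.mem_seg_left_of_len_le ha'' hz h.p_mem.1 hle) hmz
  have hmpq : m ∈ seg p q :=
    h.inter_eq ▸ ⟨ha'.seg_subset_left ha'' h.p_mem.1 hma, hm⟩
  have hmp : m ∈ seg a' p ∩ seg p q := ⟨hma, hmpq⟩
  rw [h.fit_a'.inter_eq_of_mem (ha'.right_mem_seg h.type_p) (h.type_p.left_mem_seg h.type_q),
    Set.mem_singleton_iff] at hmp
  rw [← hmp, ((hz.1.mem_seg_iff hw.1).1 (hgate w hw)).2]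

/-- The points of `I_a` after `q` project to `q` on `I_b`. -/
theorem len_eq_of_ge (h : MeetAlong a' a'' b' b'' p q) (ha' : IsType23 a') (ha'' : IsType23 a'')
    (hb' : IsType23 b') (hb'' : IsType23 b'') {z w : AffineLine k} (hz : z ∈ seg a' a'')
    (hw : w ∈ seg b' b'') (hle : len a' q ≤ len a' z) : len z w = len z q + len q w := by
  obtain ⟨m, hm, hgate⟩ := hz.1.exists_gate hb' hb''
  have hmz := hgate q h.q_mem.2
  have hma : m ∈ seg q a'' := by
    rw [hz.1.seg_comm h.type_q] at hmz
    exact h.type_q.seg_subset_left ha'' (ha'.mem_seg_right_of_len_le ha'' h.q_mem.1 hz hle) hmz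
  have hmpq : m ∈ seg p q :=
    h.inter_eq ▸ ⟨ha'.seg_subset_right ha'' h.q_mem.1 hma, hm⟩
  have hmq : m ∈ seg p q ∩ seg q a'' := ⟨hmpq, hma⟩
  rw [h.fit_a''.inter_eq_of_mem (h.type_p.right_mem_seg h.type_q) (h.type_q.left_mem_seg ha''),
    Set.mem_singleton_iff] at hmq
  rw [← hmq, ((hz.1.mem_seg_iff hw.1).1 (hgate w hw)).2]

/-- The points of `I_a` between `p` and `q` lie on `I_b`. -/
theorem len_eq_of_mem (h : MeetAlong a' a'' b' b'' p q) (ha' : IsType23 a') (ha'' : IsType23 a'')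
    (hb' : IsType23 b') (hb'' : IsType23 b'') {z w : AffineLine k} (hz : z ∈ seg a' a'')
    (hw : w ∈ seg b' b'') (hp : len a' p ≤ len a' z) (hq : len a' z ≤ len a' q) :
    len z w = |len b' p + (len a' z - len a' p) - len b' w| := by
  have hpq : len a' p ≤ len a' q := hp.trans hq
  have hzpq : z ∈ seg p q := h.type_p.mem_seg_left_of_len_le ha''
    (ha'.mem_seg_right_of_len_le ha'' h.p_mem.1 hz hp)
    (ha'.mem_seg_right_of_len_le ha'' h.p_mem.1 h.q_mem.1 hpq) (by
      rw [ha'.len_eq_abs_sub ha'' h.p_mem.1 hz, ha'.len_eq_abs_sub ha'' h.p_mem.1 h.q_mem.1,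
        abs_of_nonpos (by linarith), abs_of_nonpos (by linarith)]
      linarith)
  have hzb : z ∈ seg a' a'' ∩ seg b' b'' := h.inter_eq ▸ hzpq
  have h1 := h.len_a'_q ha' ha''
  have h2 := h.len_b'_q hb' hb''
  have h3 := ha'.len_eq_abs_sub ha'' h.p_mem.1 hz
  have h4 := ((h.type_p.mem_seg_iff h.type_q).1 hzpq).2
  have h5 := hb'.len_triangle h.type_p hz.1
  have h6 := hb'.len_triangle hz.1 h.type_q
  rw [abs_of_nonpos (by linarith)] at h3
  rw [hb'.len_eq_abs_sub hb'' hzb.2 hw, show len b' z = len b' p + (len a' z - len a' p) by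
    linarith]

/-- The distance of a point of `I_a` to a point of `I_b` in terms of their coordinates. -/
theorem len_eq (h : MeetAlong a' a'' b' b'' p q) (ha' : IsType23 a') (ha'' : IsType23 a'')
    (hb' : IsType23 b') (hb'' : IsType23 b'') {z w : AffineLine k} (hz : z ∈ seg a' a'')
    (hw : w ∈ seg b' b'') :
    len z w = |len a' z - max (len a' p) (min (len a' z) (len a' q))| +
      |len b' w - (len b' p + (max (len a' p) (min (len a' z) (len a' q)) - len a' p))| := by
  have h1 := h.len_a'_q ha' ha''
  have h2 := h.len_b'_q hb' hb''
  have h0 := h.type_p.len_nonneg h.type_q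
  -- The clamped coordinate is that of the projection of `z` to `[p,q]`; the cases put `z` before,
  -- on or after `[p,q]`.
  rcases le_total (len a' z) (len a' p) with hp | hp
  · rw [h.len_eq_of_le ha' ha'' hb' hb'' hz hw hp, ha'.len_eq_abs_sub ha'' hz h.p_mem.1,
      hb'.len_eq_abs_sub hb'' h.p_mem.2 hw, min_eq_left (by linarith), max_eq_left hp, sub_self,
      add_zero, abs_sub_comm (len b' p)]
  rcases le_total (len a' z) (len a' q) with hq | hq
  · rw [h.len_eq_of_mem ha' ha'' hb' hb'' hz hw hp hq, min_eq_left hq, max_eq_right hp, sub_self,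
      abs_zero, zero_add, abs_sub_comm]
  · rw [h.len_eq_of_ge ha' ha'' hb' hb'' hz hw hq, ha'.len_eq_abs_sub ha'' hz h.q_mem.1,
      hb'.len_eq_abs_sub hb'' h.q_mem.2 hw, min_eq_right hq, max_eq_right (by linarith),
      abs_sub_comm (len b' q), show len b' p + (len a' q - len a' p) = len b' q by linarith]

end MeetAlong

end

/-! ### Measures on segments and integrability of `log δ`. -/

section

/-! ### Bilinear integrals and Jordan decompositions -/

section Jordan

variable {α : Type*} [MeasurableSpace α] (μ ν : Measure α) [IsFiniteMeasure μ] [IsFiniteMeasure ν]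

theorem add_negPart_eq_add_posPart :
    μ + (μ.toSignedMeasure - ν.toSignedMeasure).toJordanDecomposition.negPart =
      ν + (μ.toSignedMeasure - ν.toSignedMeasure).toJordanDecomposition.posPart := by
  have h := (μ.toSignedMeasure - ν.toSignedMeasure).toSignedMeasure_toJordanDecomposition
  rw [JordanDecomposition.toSignedMeasure] at h
  rw [← Measure.toSignedMeasure_eq_toSignedMeasure_iff, Measure.toSignedMeasure_add,
    Measure.toSignedMeasure_add]
  rw [sub_eq_sub_iff_add_eq_add] at h
  rw [← h, add_comm]

/-- Minimality of the Jordan decomposition: the positive part is carried by a set where the negative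
part vanishes, and there `μ + N = ν + P` gives `P ≤ μ`. -/
theorem posPart_le :
    (μ.toSignedMeasure - ν.toSignedMeasure).toJordanDecomposition.posPart ≤ μ := by
  have h := add_negPart_eq_add_posPart μ ν
  obtain ⟨s, hs, hpos, hneg⟩ :=
    (μ.toSignedMeasure - ν.toSignedMeasure).toJordanDecomposition.mutuallySingular
  generalize (μ.toSignedMeasure - ν.toSignedMeasure).toJordanDecomposition.posPart = P at *
  generalize (μ.toSignedMeasure - ν.toSignedMeasure).toJordanDecomposition.negPart = N at *
  refine Measure.le_iff.2 fun A hA => ?_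
  have h1 := congrArg (fun m => m (A ∩ sᶜ)) h
  simp only [Measure.add_apply, measure_mono_null Set.inter_subset_right hneg, add_zero] at h1
  calc P A ≤ P (A ∩ s) + P (A ∩ sᶜ) := by
        rw [← measure_inter_add_sdiff A hs, Set.sdiff_eq]
    _ = P (A ∩ sᶜ) := by rw [measure_mono_null Set.inter_subset_right hpos, zero_add]
    _ ≤ μ (A ∩ sᶜ) := h1 ▸ le_add_self
    _ ≤ μ A := measure_mono Set.inter_subset_left

theorem negPart_le :
    (μ.toSignedMeasure - ν.toSignedMeasure).toJordanDecomposition.negPart ≤ ν := by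
  have h := posPart_le ν μ
  rwa [← neg_sub, SignedMeasure.toJordanDecomposition_neg, JordanDecomposition.neg_posPart] at h

theorem totalVariation_le :
    (μ.toSignedMeasure - ν.toSignedMeasure).totalVariation ≤ μ + ν :=
  add_le_add (posPart_le μ ν) (negPart_le μ ν)

/-- The expansion of a bilinear integral along two decompositions of a signed measure. -/
theorem integral_prod_sub_eq {P N : Measure α} [IsFiniteMeasure P] [IsFiniteMeasure N]
    {f : α × α → ℝ} (hP : P ≤ μ) (hN : N ≤ ν) (h : μ + N = ν + P)
    (hf : Integrable f ((μ + ν).prod (μ + ν))) :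
    (∫ z, f z ∂P.prod P) - (∫ z, f z ∂P.prod N) - (∫ z, f z ∂N.prod P) + (∫ z, f z ∂N.prod N) =
    (∫ z, f z ∂μ.prod μ) - (∫ z, f z ∂μ.prod ν) - (∫ z, f z ∂ν.prod μ) + (∫ z, f z ∂ν.prod ν) := by
  have hμ : μ ≤ μ + ν := Measure.le_add_right le_rfl
  have hν : ν ≤ μ + ν := Measure.le_add_left le_rfl
  have hint : ∀ {σ τ : Measure α}, σ ≤ μ + ν → τ ≤ μ + ν → Integrable f (σ.prod τ) :=
    fun hσ hτ => hf.mono_measure (Measure.prod_mono hσ hτ)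
  have hP := hP.trans hμ
  have hN := hN.trans hν
  -- The relation `μ + N = ν + P` is applied in each variable, so that only sums of positive
  -- measures occur; four instances give the result.
  have hleft : ∀ σ : Measure α, IsFiniteMeasure σ → σ ≤ μ + ν →
      (∫ z, f z ∂μ.prod σ) + (∫ z, f z ∂N.prod σ) =
        (∫ z, f z ∂ν.prod σ) + (∫ z, f z ∂P.prod σ) := by
    intro σ _ hσ
    rw [← integral_add_measure (hint hμ hσ) (hint hN hσ), ← Measure.add_prod, h, Measure.add_prod,
      integral_add_measure (hint hν hσ) (hint hP hσ)]
  have hright : ∀ σ : Measure α, IsFiniteMeasure σ → σ ≤ μ + ν →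
      (∫ z, f z ∂σ.prod μ) + (∫ z, f z ∂σ.prod N) =
        (∫ z, f z ∂σ.prod ν) + (∫ z, f z ∂σ.prod P) := by
    intro σ _ hσ
    rw [← integral_add_measure (hint hσ hμ) (hint hσ hN), ← Measure.prod_add, h, Measure.prod_add,
      integral_add_measure (hint hσ hν) (hint hσ hP)]
  have h1 := hleft P inferInstance hP
  have h2 := hleft N inferInstance hN
  have h3 := hright μ inferInstance hμ
  have h4 := hright ν inferInstance hν
  linarith

end Jordan

/-! ### The normalized Lebesgue measure of an interval -/

/-- The normalized Lebesgue measure of `[0,l]`, and the Dirac measure at `0` if `l = 0`. -/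
def coordMeasure (l : ℝ) : Measure ℝ :=
  open Classical in
  if l = 0 then Measure.dirac 0 else (ENNReal.ofReal l)⁻¹ • volume.restrict (Set.Icc 0 l)

theorem coordMeasure_zero : coordMeasure 0 = Measure.dirac 0 := if_pos rfl

theorem coordMeasure_of_pos {l : ℝ} (hl : 0 < l) :
    coordMeasure l = (ENNReal.ofReal l)⁻¹ • volume.restrict (Set.Icc 0 l) := if_neg hl.ne'

theorem isProbabilityMeasure_coordMeasure {l : ℝ} (hl : 0 ≤ l) :
    IsProbabilityMeasure (coordMeasure l) := by
  rcases hl.eq_or_lt with rfl | hl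
  · rw [coordMeasure_zero]
    infer_instance
  · rw [coordMeasure_of_pos hl]
    refine ⟨?_⟩
    rw [Measure.smul_apply, Measure.restrict_apply_univ, Real.volume_Icc, sub_zero, smul_eq_mul]
    exact ENNReal.inv_mul_cancel (by simpa using hl) ENNReal.ofReal_ne_top

theorem ae_coordMeasure_mem {l : ℝ} (hl : 0 ≤ l) : ∀ᵐ t ∂coordMeasure l, t ∈ Set.Icc 0 l := by
  rcases hl.eq_or_lt with rfl | hl
  · rw [coordMeasure_zero]
    exact (ae_dirac_iff (p := fun t => t ∈ Set.Icc (0 : ℝ) 0) measurableSet_Icc).2 (by simp)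
  · rw [coordMeasure_of_pos hl]
    exact Measure.ae_smul_measure (ae_restrict_mem measurableSet_Icc) _

theorem integral_coordMeasure_of_pos {l : ℝ} (hl : 0 < l) (f : ℝ → ℝ) :
    ∫ t, f t ∂coordMeasure l = l⁻¹ * ∫ t in (0 : ℝ)..l, f t := by
  rw [coordMeasure_of_pos hl, integral_smul_measure, intervalIntegral.integral_of_le hl.le,
    integral_Icc_eq_integral_Ioc, ENNReal.toReal_inv, ENNReal.toReal_ofReal hl.le, smul_eq_mul]

theorem integral_abs_sub {l c : ℝ} (h0 : 0 ≤ c) (hc : c ≤ l) :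
    ∫ t in (0 : ℝ)..l, |t - c| = (c ^ 2 + (l - c) ^ 2) / 2 := by
  have hint : ∀ a b : ℝ, IntervalIntegrable (fun t : ℝ => |t - c|) volume a b :=
    fun a b => Continuous.intervalIntegrable (by fun_prop) a b
  rw [← intervalIntegral.integral_add_adjacent_intervals (hint 0 c) (hint c l)]
  have h1 : ∫ t in (0 : ℝ)..c, |t - c| = ∫ t in (0 : ℝ)..c, -(t - c) := by
    refine intervalIntegral.integral_congr fun t ht => ?_
    rw [Set.uIcc_of_le h0] at ht
    simp only [abs_of_nonpos (sub_nonpos.2 ht.2)]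
  have h2 : ∫ t in c..l, |t - c| = ∫ t in c..l, (t - c) := by
    refine intervalIntegral.integral_congr fun t ht => ?_
    rw [Set.uIcc_of_le hc] at ht
    simp only [abs_of_nonneg (sub_nonneg.2 ht.1)]
  rw [h1, h2, intervalIntegral.integral_neg, intervalIntegral.integral_comp_sub_right fun t => t,
    intervalIntegral.integral_comp_sub_right fun t => t, integral_id, integral_id]
  ring

theorem integral_coordMeasure_abs_sub {l c : ℝ} (h0 : 0 ≤ c) (hc : c ≤ l) :
    ∫ t, |t - c| ∂coordMeasure l = (c ^ 2 + (l - c) ^ 2) / (2 * l) := by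
  -- For `l = 0` the Dirac integral vanishes, in agreement with division by zero.
  rcases (h0.trans hc).eq_or_lt with rfl | hl
  · rw [coordMeasure_zero, integral_dirac, le_antisymm hc h0]
    simp
  · rw [integral_coordMeasure_of_pos hl, integral_abs_sub h0 hc]
    field_simp

/-! ### The measure of a segment -/

section Topology

variable {k : Type*} [NormedField k]

theorem AffineLine.continuous_eval (P : k[X]) : Continuous fun x : AffineLine k => x.eval P :=
  (continuous_apply P).comp continuous_induced_dom

instance : T2Space (AffineLine k) :=
  T2Space.of_injective_continuous (f := AffineLine.eval)
    (fun _ _ h => AffineLine.ext (congrFun h)) continuous_induced_dom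

/-- An infimum of continuous functions, even over an uncountable family, is upper semicontinuous. -/
theorem measurable_kernel_comp {X : Type*} [TopologicalSpace X] [MeasurableSpace X]
    [OpensMeasurableSpace X] {f g : X → AffineLine k} (hf : Continuous f) (hg : Continuous g) :
    Measurable fun z => kernel (f z) (g z) := by
  refine UpperSemicontinuous.measurable (upperSemicontinuous_ciInf (fun z => ⟨0, ?_⟩) fun P => ?_)
  · rintro _ ⟨P, rfl⟩
    exact Real.rpow_nonneg (le_max_of_le_left (AffineLine.eval_nonneg _ _)) _
  · refine Continuous.upperSemicontinuous (Continuous.rpow_const ?_ fun _ => Or.inr (by positivity))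
    exact ((AffineLine.continuous_eval _).comp hf).max ((AffineLine.continuous_eval _).comp hg)

theorem measurable_len (x : AffineLine k) : Measurable fun z => len x z :=
  (((measurable_kernel_comp continuous_const continuous_id).log.const_mul 2).sub_const _).sub
    (measurable_kernel_comp continuous_id continuous_id).log

end Topology

variable {k : Type*} [NormedField k] [IsUltrametricDist k] [CompleteSpace k]

/-- The measure of a segment is the image of that of an interval by a continuous
parametrization. -/
theorem IsType23.exists_segMeasure_eq_map {x y : AffineLine k} (hx : IsType23 x)
    (hy : IsType23 y) : ∃ f : ℝ → AffineLine k, Continuous f ∧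
      (∀ t ∈ Set.Icc 0 (len x y), f t ∈ seg x y ∧ len x (f t) = t) ∧
      segMeasure x y = (coordMeasure (len x y)).map f := by
  obtain ⟨f, hf, hft⟩ := hx.exists_param hy
  refine ⟨f, hf, hft, ?_⟩
  rcases eq_or_ne x y with rfl | hxy
  · have h0 := hft 0 (by simp [len_self])
    rw [segMeasure, if_pos rfl, len_self, coordMeasure_zero, Measure.map_dirac' hf.measurable,
      hx.eq_of_mem_seg hx h0.1 (hx.left_mem_seg hx) (by rw [h0.2, len_self])]
  · have hl : 0 < len x y :=
      (hx.len_nonneg hy).lt_of_ne fun h => hxy (hx.eq_of_len_eq_zero hy h.symm)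
    rw [segMeasure, if_neg hxy, coordMeasure_of_pos hl, Measure.map_smul]
    congr 1
    -- `segParam` is a choice of inverse with no evident measurability, but on `[0, len x y]` it
    -- must agree with the continuous `f`.
    refine Measure.map_congr ?_
    filter_upwards [ae_restrict_mem measurableSet_Icc] with t ht
    have hex : ∃ z ∈ seg x y, len x z = t := ⟨f t, hft t ht⟩
    have : Nonempty (AffineLine k) := ⟨x⟩
    exact hx.eq_of_mem_seg hy (Function.invFunOn_mem hex) (hft t ht).1
      ((Function.invFunOn_eq hex).trans (hft t ht).2.symm)

theorem IsType23.measurableSet_seg {x y : AffineLine k} (hx : IsType23 x) (hy : IsType23 y) :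
    MeasurableSet (seg x y) := by
  obtain ⟨f, hf, hft⟩ := hx.exists_param hy
  have h : seg x y = f '' Set.Icc 0 (len x y) := by
    ext z
    constructor
    · intro hz
      have h1 := ((hx.mem_seg_iff hy).1 hz).2
      have ht : len x z ∈ Set.Icc 0 (len x y) :=
        ⟨hx.len_nonneg hz.1, by linarith [hz.1.len_nonneg hy]⟩
      exact ⟨len x z, ht, hx.eq_of_mem_seg hy (hft _ ht).1 hz (hft _ ht).2⟩
    · rintro ⟨t, ht, rfl⟩
      exact (hft t ht).1
  rw [h]
  exact (isCompact_Icc.image hf).isClosed.measurableSet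

theorem IsType23.ae_segMeasure_mem {x y : AffineLine k} (hx : IsType23 x) (hy : IsType23 y) :
    ∀ᵐ z ∂segMeasure x y, z ∈ seg x y := by
  obtain ⟨f, hf, hft, h⟩ := hx.exists_segMeasure_eq_map hy
  rw [h]
  refine (ae_map_iff (p := fun z => z ∈ seg x y) hf.measurable.aemeasurable
    (hx.measurableSet_seg hy)).2 ?_
  filter_upwards [ae_coordMeasure_mem (hx.len_nonneg hy)] with t ht using (hft t ht).1

/-- The length and half of each diagonal term vary at most as fast as the end points move. -/
theorem IsType23.abs_gromov_sub_le {x y z w : AffineLine k} (hx : IsType23 x) (hy : IsType23 y)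
    (hz : IsType23 z) (hw : IsType23 w) :
    |gromov x y - gromov z w| ≤ len x z + len y w := by
  have h1 := abs_le.1 (hx.abs_gromov_self_sub_le hz)
  have h2 := abs_le.1 (hy.abs_gromov_self_sub_le hw)
  have h3 := hx.len_triangle hz hy
  have h4 := hz.len_triangle hw hy
  have h5 := hz.len_triangle hx hw
  have h6 := hx.len_triangle hy hw
  rw [len_comm z x] at h5
  rw [len_comm w y] at h4
  have h7 := len_eq x y
  have h8 := len_eq z w
  rw [abs_le]
  constructor <;> linarith

theorem ae_prod_segMeasure_mem {x y x' y' : AffineLine k} (hx : IsType23 x) (hy : IsType23 y)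
    (hx' : IsType23 x') (hy' : IsType23 y') :
    ∀ᵐ z ∂(segMeasure x y).prod (segMeasure x' y'), z.1 ∈ seg x y ∧ z.2 ∈ seg x' y' :=
  (Measure.quasiMeasurePreserving_fst.ae (hx.ae_segMeasure_mem hy)).and
    (Measure.quasiMeasurePreserving_snd.ae (hx'.ae_segMeasure_mem hy'))

theorem abs_projIcc_sub_le (l s t : ℝ) :
    |max 0 (min s l) - max 0 (min t l)| ≤ |s - t| := by
  grind

/-- On two segments, the kernel is a continuous function of the coordinates. -/
theorem exists_continuous_gromov {x y x' y' : AffineLine k} (hx : IsType23 x) (hy : IsType23 y)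
    (hx' : IsType23 x') (hy' : IsType23 y') :
    ∃ H : ℝ × ℝ → ℝ, Continuous H ∧
      ∀ z ∈ seg x y, ∀ w ∈ seg x' y', H (len x z, len x' w) = gromov z w := by
  obtain ⟨f, -, hft⟩ := hx.exists_param hy
  obtain ⟨g, -, hgt⟩ := hx'.exists_param hy'
  have hmem : ∀ {x y : AffineLine k}, IsType23 x → IsType23 y → ∀ t,
      max 0 (min t (len x y)) ∈ Set.Icc 0 (len x y) := fun hx hy t =>
    ⟨le_max_left _ _, max_le (hx.len_nonneg hy) (min_le_right _ _)⟩
  have hclamp : ∀ {x y z : AffineLine k}, IsType23 x → IsType23 y → z ∈ seg x y →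
      max 0 (min (len x z) (len x y)) = len x z := fun hx hy hz => by
    have h1 := ((hx.mem_seg_iff hy).1 hz).2
    have h2 := hz.1.len_nonneg hy
    rw [min_eq_left (by linarith), max_eq_right (hx.len_nonneg hz.1)]
  refine ⟨fun p => gromov (f (max 0 (min p.1 (len x y)))) (g (max 0 (min p.2 (len x' y')))),
    LipschitzWith.continuous (K := 2) (LipschitzWith.of_dist_le_mul fun p q => ?_),
    fun z hz w hw => ?_⟩
  · have hp1 := hft _ (hmem hx hy p.1)
    have hq1 := hft _ (hmem hx hy q.1)
    have hp2 := hgt _ (hmem hx' hy' p.2)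
    have hq2 := hgt _ (hmem hx' hy' q.2)
    have h := hp1.1.1.abs_gromov_sub_le hp2.1.1 hq1.1.1 hq2.1.1
    rw [hx.len_eq_abs_sub hy hp1.1 hq1.1, hx'.len_eq_abs_sub hy' hp2.1 hq2.1, hp1.2, hp2.2, hq1.2,
      hq2.2] at h
    have h1 := abs_projIcc_sub_le (len x y) p.1 q.1
    have h2 := abs_projIcc_sub_le (len x' y') p.2 q.2
    have h3 : |p.1 - q.1| ≤ dist p q := le_max_left _ _
    have h4 : |p.2 - q.2| ≤ dist p q := le_max_right _ _
    rw [Real.dist_eq, NNReal.coe_ofNat]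
    linarith
  · have h1 := hft _ (hmem hx hy (len x z))
    have h2 := hgt _ (hmem hx' hy' (len x' w))
    have e1 := hx.eq_of_mem_seg hy h1.1 hz (h1.2.trans (hclamp hx hy hz))
    have e2 := hx'.eq_of_mem_seg hy' h2.1 hw (h2.2.trans (hclamp hx' hy' hw))
    dsimp only
    rw [e1, e2]

theorem integrable_logKernel {x y x' y' : AffineLine k} (hx : IsType23 x) (hy : IsType23 y)
    (hx' : IsType23 x') (hy' : IsType23 y') :
    Integrable logKernel ((segMeasure x y).prod (segMeasure x' y')) := by
  obtain ⟨H, hH, hHeq⟩ := exists_continuous_gromov hx hy hx' hy'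
  have hae := ae_prod_segMeasure_mem hx hy hx' hy'
  have hlen : Measurable fun z : AffineLine k × AffineLine k => (len x z.1, len x' z.2) :=
    ((measurable_len x).comp measurable_fst).prodMk ((measurable_len x').comp measurable_snd)
  -- Semicontinuity would give measurability for the Borel σ-algebra of the product, which may
  -- exceed the product σ-algebra; passing through the real coordinates avoids this.
  have hmeas : AEStronglyMeasurable logKernel ((segMeasure x y).prod (segMeasure x' y')) := by
    refine AEStronglyMeasurable.congr (hH.measurable.comp hlen).aestronglyMeasurable ?_
    filter_upwards [hae] with z hz using hHeq z.1 hz.1 z.2 hz.2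
  refine Integrable.of_bound hmeas (|gromov x x'| + len x y + len x' y') ?_
  filter_upwards [hae] with z hz
  have h := hz.1.1.abs_gromov_sub_le hz.2.1 hx hx'
  have h1 := ((hx.mem_seg_iff hy).1 hz.1).2
  have h2 := ((hx'.mem_seg_iff hy').1 hz.2).2
  have h3 := hz.1.1.len_nonneg hy
  have h4 := hz.2.1.len_nonneg hy'
  have h5 := abs_sub_abs_le_abs_sub (gromov z.1 z.2) (gromov x x')
  rw [len_comm z.1 x, len_comm z.2 x'] at h
  change |gromov z.1 z.2| ≤ _
  linarith

theorem integrable_logKernel_add {x y x' y' : AffineLine k} (hx : IsType23 x) (hy : IsType23 y)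
    (hx' : IsType23 x') (hy' : IsType23 y') :
    Integrable logKernel ((segMeasure x y + segMeasure x' y').prod
      (segMeasure x y + segMeasure x' y')) := by
  rw [Measure.prod_add, Measure.add_prod, Measure.add_prod]
  exact ((integrable_logKernel hx hy hx hy).add_measure
    (integrable_logKernel hx' hy' hx hy)).add_measure
    ((integrable_logKernel hx hy hx' hy').add_measure (integrable_logKernel hx' hy' hx' hy'))

theorem hasEnergy_segDiff {x y x' y' : AffineLine k} (hx : IsType23 x) (hy : IsType23 y)
    (hx' : IsType23 x') (hy' : IsType23 y') :
    HasEnergy (segDiff x y x' y') (segDiff x y x' y') :=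
  (integrable_logKernel_add hx hy hx' hy').mono_measure
    (Measure.prod_mono (totalVariation_le _ _) (totalVariation_le _ _))

theorem segEnergy_eq {x y x' y' : AffineLine k} (hx : IsType23 x) (hy : IsType23 y)
    (hx' : IsType23 x') (hy' : IsType23 y') :
    segEnergy x y x' y' = -(1 / 2) *
      (kernelIntegral (segMeasure x y) (segMeasure x y)
        - kernelIntegral (segMeasure x y) (segMeasure x' y')
        - kernelIntegral (segMeasure x' y') (segMeasure x y)
        + kernelIntegral (segMeasure x' y') (segMeasure x' y')) := by
  have h := integral_prod_sub_eq _ _ (posPart_le (segMeasure x y) (segMeasure x' y'))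
    (negPart_le (segMeasure x y) (segMeasure x' y')) (add_negPart_eq_add_posPart _ _)
    (integrable_logKernel_add hx hy hx' hy')
  simp only [segEnergy, energyPairing, kernelIntegral, segDiff]
  rw [h]
  ring

end

/-! ### Mean distances and the energy. -/

section

/-! ### Mean distances in coordinates -/

theorem integrable_coordMeasure {l : ℝ} (hl : 0 ≤ l) {f : ℝ → ℝ} (hf : Continuous f) :
    Integrable f (coordMeasure l) := by
  have := isProbabilityMeasure_coordMeasure hl
  obtain ⟨C, hC⟩ := isCompact_Icc.exists_bound_of_continuousOn (s := Set.Icc 0 l) hf.continuousOn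
  refine Integrable.of_bound hf.aestronglyMeasurable C ?_
  filter_upwards [ae_coordMeasure_mem hl] with t ht using hC t ht

/-- The integral over `I_a` of the distance to the projection on `I_ab` plus a function `Q` of that
projection, which is constant on the two outer pieces. -/
theorem integral_clamp {u m w : ℝ} (hu : 0 ≤ u) (hm : 0 ≤ m) (hw : 0 ≤ w) {Q : ℝ → ℝ}
    (hQ : Continuous Q) :
    ∫ t in (0 : ℝ)..(u + m + w),
        (|t - max u (min t (u + m))| + Q (max u (min t (u + m)) - u)) =
      u ^ 2 / 2 + u * Q 0 + (∫ t in (0 : ℝ)..m, Q t) + w ^ 2 / 2 + w * Q m := by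
  have hint : ∀ a b : ℝ, IntervalIntegrable
      (fun t : ℝ => |t - max u (min t (u + m))| + Q (max u (min t (u + m)) - u)) volume a b :=
    fun a b => Continuous.intervalIntegrable (by fun_prop) a b
  rw [← intervalIntegral.integral_add_adjacent_intervals (hint 0 (u + m)) (hint (u + m) _),
    ← intervalIntegral.integral_add_adjacent_intervals (hint 0 u) (hint u (u + m))]
  have h1 : ∫ t in (0 : ℝ)..u, (|t - max u (min t (u + m))| + Q (max u (min t (u + m)) - u)) =
      ∫ t in (0 : ℝ)..u, ((u + Q 0) - t) := by
    refine intervalIntegral.integral_congr fun t ht => ?_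
    rw [Set.uIcc_of_le hu] at ht
    rw [min_eq_left (by linarith [ht.2]), max_eq_left ht.2, sub_self,
      abs_of_nonpos (sub_nonpos.2 ht.2)]
    ring
  have h2 : ∫ t in u..(u + m), (|t - max u (min t (u + m))| + Q (max u (min t (u + m)) - u)) =
      ∫ t in u..(u + m), Q (t - u) := by
    refine intervalIntegral.integral_congr fun t ht => ?_
    rw [Set.uIcc_of_le (by linarith)] at ht
    rw [min_eq_left ht.2, max_eq_right ht.1, sub_self, abs_zero, zero_add]
  have h3 : ∫ t in (u + m)..(u + m + w),
      (|t - max u (min t (u + m))| + Q (max u (min t (u + m)) - u)) =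
      ∫ t in (u + m)..(u + m + w), (t - (u + m - Q m)) := by
    refine intervalIntegral.integral_congr fun t ht => ?_
    rw [Set.uIcc_of_le (by linarith)] at ht
    rw [min_eq_right ht.1, max_eq_right (by linarith), abs_of_nonneg (sub_nonneg.2 ht.1),
      add_sub_cancel_left]
    ring
  rw [h1, h2, h3, intervalIntegral.integral_comp_sub_left fun t => t,
    intervalIntegral.integral_comp_sub_right Q, intervalIntegral.integral_comp_sub_right fun t => t,
    integral_id, integral_id, sub_self, add_sub_cancel_left]
  ring_nf

theorem integral_quadratic (v m b : ℝ) :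
    ∫ t in (0 : ℝ)..m, ((v + t) ^ 2 + (b - (v + t)) ^ 2) / (2 * b) =
      (((v + m) ^ 3 - v ^ 3) / 3 + ((b - v) ^ 3 - (b - v - m) ^ 3) / 3) / (2 * b) := by
  rw [intervalIntegral.integral_div, intervalIntegral.integral_add
    (Continuous.intervalIntegrable (by fun_prop) _ _)
    (Continuous.intervalIntegrable (by fun_prop) _ _)]
  have h2 : ∫ t in (0 : ℝ)..m, (b - (v + t)) ^ 2 = ∫ t in (0 : ℝ)..m, ((b - v) - t) ^ 2 :=
    intervalIntegral.integral_congr fun t _ => by ring_nf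
  rw [h2, intervalIntegral.integral_comp_add_left fun t => t ^ 2,
    intervalIntegral.integral_comp_sub_left fun t => t ^ 2, integral_pow, integral_pow]
  norm_num

/-- The mean distance of two segments in coordinates: the first one is `[0, u + m + w]`, the second
one `[0, v + m + w']`, and they are glued along the intervals of length `m` after `u` and `v`. -/
theorem integral_integral_dist {u m w v w' a b : ℝ} (hu : 0 ≤ u) (hm : 0 ≤ m) (hw : 0 ≤ w)
    (hv : 0 ≤ v) (hw' : 0 ≤ w') (ha : a = u + m + w) (hb : b = v + m + w') :
    ∫ t, ∫ s, (|t - max u (min t (u + m))| + |s - (v + (max u (min t (u + m)) - u))|)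
        ∂coordMeasure b ∂coordMeasure a =
      a / 2 + b / 2 - m + m ^ 3 / (3 * (a * b)) - u * w / a - v * w' / b
        - (u * v + w * w') * m / (a * b) := by
  have ha0 : 0 ≤ a := by rw [ha]; positivity
  have hb0 : 0 ≤ b := by rw [hb]; positivity
  have := isProbabilityMeasure_coordMeasure hb0
  -- For fixed `t` the first term is constant, and the second is the distance to a point of `[0,b]`,
  -- whose mean is known.
  have hinner : ∀ t : ℝ,
      ∫ s, (|t - max u (min t (u + m))| + |s - (v + (max u (min t (u + m)) - u))|)
        ∂coordMeasure b = |t - max u (min t (u + m))| +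
          ((v + (max u (min t (u + m)) - u)) ^ 2 + (b - (v + (max u (min t (u + m)) - u))) ^ 2)
            / (2 * b) := fun t => by
    have h1 : u ≤ max u (min t (u + m)) := le_max_left _ _
    have h2 : max u (min t (u + m)) ≤ u + m := max_le (by linarith) (min_le_right _ _)
    rw [integral_add (integrable_const _) (integrable_coordMeasure hb0 (by fun_prop)),
      integral_const, integral_coordMeasure_abs_sub (by linarith) (by linarith), probReal_univ,
      one_smul]
  simp only [hinner]
  -- A zero total length forces its pieces, and in particular `m`, to vanish; the fractions over it
  -- are then 0, as the Dirac measure requires.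
  rcases ha0.eq_or_lt with rfl | ha0
  · obtain rfl : u = 0 := by linarith
    obtain rfl : m = 0 := by linarith
    obtain rfl : w = 0 := by linarith
    rw [coordMeasure_zero, integral_dirac]
    rcases hb0.eq_or_lt with rfl | hb0
    · simp
    · simp only [add_zero, min_self, max_self, sub_self, abs_zero, hb]
      rw [add_zero] at hb
      rw [hb] at hb0
      field_simp
      ring
  · rw [integral_coordMeasure_of_pos ha0, ha]
    have h := integral_clamp hu hm hw
      (Q := fun t => ((v + t) ^ 2 + (b - (v + t)) ^ 2) / (2 * b)) (by fun_prop)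
    rw [h, integral_quadratic, ← ha]
    rcases hb0.eq_or_lt with rfl | hb0
    · obtain rfl : v = 0 := by linarith
      obtain rfl : m = 0 := by linarith
      obtain rfl : w' = 0 := by linarith
      simp only [mul_zero, div_zero, add_zero, sub_zero, zero_div]
      rw [add_zero] at ha
      field_simp
      rw [ha]
      ring
    · field_simp
      rw [ha, hb]
      ring

/-! ### Mean distances of segments -/

variable {k : Type*} [NormedField k]

theorem logKernel_eq (z : AffineLine k × AffineLine k) :
    logKernel z = 1 / 2 * (len z.1 z.2 + gromov z.1 z.1 + gromov z.2 z.2) := by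
  rw [len_eq]
  change gromov z.1 z.2 = _
  ring

theorem kernelIntegral_comm (μ ν : Measure (AffineLine k)) [SFinite μ] [SFinite ν] :
    kernelIntegral μ ν = kernelIntegral ν μ := by
  rw [kernelIntegral, kernelIntegral, ← integral_prod_swap]
  simp only [logKernel, Prod.fst_swap, Prod.snd_swap, fun z w : AffineLine k => kernel_comm z w]

variable [IsUltrametricDist k] [CompleteSpace k]

theorem IsType23.isProbabilityMeasure_segMeasure {x y : AffineLine k} (hx : IsType23 x)
    (hy : IsType23 y) : IsProbabilityMeasure (segMeasure x y) := by
  obtain ⟨f, hf, -, h⟩ := hx.exists_segMeasure_eq_map hy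
  have := isProbabilityMeasure_coordMeasure (hx.len_nonneg hy)
  rw [h]
  exact Measure.isProbabilityMeasure_map hf.measurable.aemeasurable

theorem IsType23.integrable_gromov_self {x y : AffineLine k} (hx : IsType23 x)
    (hy : IsType23 y) : Integrable (fun z => gromov z z) (segMeasure x y) := by
  refine Integrable.of_bound
    (measurable_kernel_comp continuous_id continuous_id).log.aestronglyMeasurable
    (|gromov x x| + len x y) ?_
  filter_upwards [hx.ae_segMeasure_mem hy] with z hz
  have h := hz.1.abs_gromov_self_sub_le hx
  have h1 := ((hx.mem_seg_iff hy).1 hz).2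
  have h2 := hz.1.len_nonneg hy
  have h3 := abs_sub_abs_le_abs_sub (gromov z z) (gromov x x)
  rw [len_comm z x] at h
  rw [Real.norm_eq_abs]
  change |gromov z z| ≤ _
  linarith

section Pair

variable {x y x' y' : AffineLine k}

theorem integrable_len (hx : IsType23 x) (hy : IsType23 y) (hx' : IsType23 x')
    (hy' : IsType23 y') :
    Integrable (fun z : AffineLine k × AffineLine k => len z.1 z.2)
      ((segMeasure x y).prod (segMeasure x' y')) :=
  (((integrable_logKernel hx hy hx' hy').const_mul 2).sub
    ((hx.integrable_gromov_self hy).comp_fst _)).sub ((hx'.integrable_gromov_self hy').comp_snd _)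

theorem kernelIntegral_eq (hx : IsType23 x) (hy : IsType23 y) (hx' : IsType23 x')
    (hy' : IsType23 y') :
    kernelIntegral (segMeasure x y) (segMeasure x' y') =
      1 / 2 * ((∫ z, len z.1 z.2 ∂(segMeasure x y).prod (segMeasure x' y'))
        + (∫ z, gromov z z ∂segMeasure x y) + ∫ z, gromov z z ∂segMeasure x' y') := by
  have := hx.isProbabilityMeasure_segMeasure hy
  have := hx'.isProbabilityMeasure_segMeasure hy'
  have h1 := (hx.integrable_gromov_self hy).comp_fst (segMeasure x' y')
  have h2 := (hx'.integrable_gromov_self hy').comp_snd (segMeasure x y)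
  have h3 := integrable_len hx hy hx' hy'
  simp only [kernelIntegral, logKernel_eq]
  rw [integral_const_mul, integral_add (by exact h3.add h1) h2, integral_add h3 h1,
    integral_fun_fst fun z => gromov z z, integral_fun_snd fun z => gromov z z, probReal_univ,
    probReal_univ, one_smul, one_smul]

/-- The mean distance of two segments, if distances are given by a function of the coordinates. -/
theorem integral_len_eq (hx : IsType23 x) (hy : IsType23 y) (hx' : IsType23 x')
    (hy' : IsType23 y') {D : ℝ → ℝ → ℝ}
    (hD : ∀ z ∈ seg x y, ∀ w ∈ seg x' y', len z w = D (len x z) (len x' w)) :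
    ∫ z, len z.1 z.2 ∂(segMeasure x y).prod (segMeasure x' y') =
      ∫ t, ∫ s, D t s ∂coordMeasure (len x' y') ∂coordMeasure (len x y) := by
  have hint := integrable_len hx hy hx' hy'
  obtain ⟨f, hf, hft, hμ⟩ := hx.exists_segMeasure_eq_map hy
  obtain ⟨g, hg, hgt, hν⟩ := hx'.exists_segMeasure_eq_map hy'
  have := isProbabilityMeasure_coordMeasure (hx.len_nonneg hy)
  have := isProbabilityMeasure_coordMeasure (hx'.len_nonneg hy')
  have hfg : AEMeasurable (Prod.map f g)
      ((coordMeasure (len x y)).prod (coordMeasure (len x' y'))) :=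
    (hf.measurable.prodMap hg.measurable).aemeasurable
  rw [hμ, hν, Measure.map_prod_map _ _ hf.measurable hg.measurable] at hint ⊢
  have hae : (fun z : AffineLine k × AffineLine k => len z.1 z.2) ∘ Prod.map f g
      =ᵐ[(coordMeasure (len x y)).prod (coordMeasure (len x' y'))] fun p => D p.1 p.2 := by
    filter_upwards [Measure.quasiMeasurePreserving_fst.ae
      (ae_coordMeasure_mem (hx.len_nonneg hy)), Measure.quasiMeasurePreserving_snd.ae
      (ae_coordMeasure_mem (hx'.len_nonneg hy'))] with p h1 h2
    have h1 := hft _ h1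
    have h2 := hgt _ h2
    have h := hD _ h1.1 _ h2.1
    rwa [h1.2, h2.2] at h
  rw [integral_map hfg hint.aestronglyMeasurable,
    ← integral_prod _ ((hint.comp_aemeasurable hfg).congr hae)]
  exact integral_congr_ae hae

end Pair

theorem MeetAlong.integral_len {a' a'' b' b'' p q : AffineLine k}
    (h : MeetAlong a' a'' b' b'' p q) (ha' : IsType23 a') (ha'' : IsType23 a'')
    (hb' : IsType23 b') (hb'' : IsType23 b'') :
    ∫ z, len z.1 z.2 ∂(segMeasure a' a'').prod (segMeasure b' b'') =
      len a' a'' / 2 + len b' b'' / 2 - len p q + len p q ^ 3 / (3 * (len a' a'' * len b' b''))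
        - len a' p * len q a'' / len a' a'' - len b' p * len q b'' / len b' b''
        - (len a' p * len b' p + len q a'' * len q b'') * len p q
          / (len a' a'' * len b' b'') := by
  rw [integral_len_eq ha' ha'' hb' hb'' (D := fun t s => |t - max (len a' p) (min t (len a' q))| +
      |s - (len b' p + (max (len a' p) (min t (len a' q)) - len a' p))|)
    fun z hz w hw => h.len_eq ha' ha'' hb' hb'' hz hw, h.len_a'_q ha' ha'']
  exact integral_integral_dist (ha'.len_nonneg h.type_p) (h.type_p.len_nonneg h.type_q)
    (h.type_q.len_nonneg ha'') (hb'.len_nonneg h.type_p) (h.type_q.len_nonneg hb'')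
    (h.len_a ha' ha'') (h.len_b hb' hb'')

/-- Makes the mean distance inside one segment a case of that between two. -/
theorem IsType23.meetAlong_self {x y : AffineLine k} (hx : IsType23 x) (hy : IsType23 y) :
    MeetAlong x y x y x y :=
  have h : len x x ≤ len x y := (len_self x).trans_le (hx.len_nonneg hy)
  meetAlong_of_len_le hx hy hx hy (Set.inter_self _) (hx.left_mem_seg hy) (hx.right_mem_seg hy)
    (hx.left_mem_seg hy) (hx.right_mem_seg hy) h h

theorem IsType23.integral_len_self {x y : AffineLine k} (hx : IsType23 x) (hy : IsType23 y) :
    ∫ z, len z.1 z.2 ∂(segMeasure x y).prod (segMeasure x y) = len x y / 3 := by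
  rw [(hx.meetAlong_self hy).integral_len hx hy hx hy, len_self, len_self]
  rcases eq_or_ne (len x y) 0 with h | h
  · simp [h]
  · field_simp
    ring

/-- The energy of two segments in terms of their mean distance. -/
theorem segEnergy_eq_integral_len {a' a'' b' b'' : AffineLine k} (ha' : IsType23 a')
    (ha'' : IsType23 a'') (hb' : IsType23 b') (hb'' : IsType23 b'') :
    segEnergy a' a'' b' b'' = 1 / 2 *
      (∫ z, len z.1 z.2 ∂(segMeasure a' a'').prod (segMeasure b' b''))
      - len a' a'' / 12 - len b' b'' / 12 := by
  rw [segEnergy_eq ha' ha'' hb' hb'', kernelIntegral_comm (segMeasure b' b''),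
    kernelIntegral_eq ha' ha'' ha' ha'', kernelIntegral_eq ha' ha'' hb' hb'',
    kernelIntegral_eq hb' hb'' hb' hb'', ha'.integral_len_self ha'', hb'.integral_len_self hb'']
  ring

end

end Berkovich

end

theorem mainTheorem8 {k : Type*} [NormedField k] [IsUltrametricDist k] [CompleteSpace k]
    (a' a'' b' b'' : Berkovich.AffineLine k)
    (ha' : Berkovich.IsType23 a') (ha'' : Berkovich.IsType23 a'')
    (hb' : Berkovich.IsType23 b') (hb'' : Berkovich.IsType23 b'')
    (hne : (Berkovich.seg a' a'' ∩ Berkovich.seg b' b'').Nonempty) :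
    Berkovich.HasEnergy (Berkovich.segDiff a' a'' b' b'') (Berkovich.segDiff a' a'' b' b'') ∧
    (∃ p q, Berkovich.MeetAlong a' a'' b' b'' p q ∨ Berkovich.MeetAlong a' a'' b'' b' p q) ∧
    ∀ p q, Berkovich.MeetAlong a' a'' b' b'' p q →
      ∀ la la' la'' lb lb' lb'' lab : ℝ,
        la = Berkovich.len a' a'' → la' = Berkovich.len a' p → la'' = Berkovich.len q a'' →
        lb = Berkovich.len b' b'' → lb' = Berkovich.len b' p → lb'' = Berkovich.len q b'' →
        lab = Berkovich.len p q →
        Berkovich.segEnergy a' a'' b' b'' =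
          1 / 6 * la + 1 / 6 * lb - 1 / 2 * lab + 1 / 6 * (lab ^ 3 / (la * lb))
            - 1 / 2 * (la' * la'' / la) - 1 / 2 * (lb' * lb'' / lb)
            - 1 / 2 * ((la' * lb' + la'' * lb'') * lab / (la * lb)) := by
  refine ⟨Berkovich.hasEnergy_segDiff ha' ha'' hb' hb'',
    Berkovich.exists_meetAlong ha' ha'' hb' hb'' hne, ?_⟩
  rintro p q h _ _ _ _ _ _ _ rfl rfl rfl rfl rfl rfl rfl
  -- Division by zero is read alike on both sides, so after splitting the denominators `ring` needs
  -- no nonvanishing of the lengths.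
  rw [Berkovich.segEnergy_eq_integral_len ha' ha'' hb' hb'', h.integral_len ha' ha'' hb' hb'',
    mul_comm (3 : ℝ), ← div_div]
  ring
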